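/- **Setting.** Let $d\ge 1$. A $d$-weighted reachability game is given by a finite non-empty directed graph $(V,E)$ in which every vertex has a successor, a partition $V=V_1\uplus V_2$ (vertices of players 1 and 2), weights $\mathbf w(v,u)\in\mathbb N^d$ for $(v,u)\in E$, and a target set $F\subseteq V$. The cost profile of an infinite path $\rho_0\rho_1\dots$ is $\sum_{m<\ell}\mathbf w(\rho_m,\rho_{m+1})$, where $\ell$ is the least index with $\rho_\ell\in F$, and $(\infty,\dots,\infty)$ if there is no such index. Strategies map histories to successors of their last vertex. Cost profiles in $(\mathbb N\cup\{\infty\})^d$ are compared by the lexicographic order $\le_L$; $\mathrm{minimal}(X)$ is the set of $\le_L$-minimal elements of $X$, and $\uparrow X$ is the upward closure of $X$. A profile $\mathbf x$ is ensured from $v$ if player 1 has a strategy from $v$ such that, against every strategy of player 2 from $v$, the cost profile of the outcome is $\le_L\mathbf x$. The upper value from $v$ is the set of minimal ensured profiles. The *fixpoint algorithm* starts with $I^0(v)=\{\mathbf 0\}$ for $v\in F$ and $I^0(v)=\{(\infty,\dots,\infty)\}$ for $v\notin F$. It computes, for $k=0,1,\dots$ and all $v\in V$, $$I^{k+1}(v)=\begin{cases}\{\mathbf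 0\} & v\in F,\\ \mathrm{minimal}\bigl(\bigcup_{(v,u)\in E}\uparrow(I^k(u)+\mathbf w(v,u))\bigr) & v\in V_1\setminus F,\\ \mathrm{minimal}\bigl(\bigcap_{(v,u)\in E}\uparrow(I^k(u)+\mathbf w(v,u))\bigr) & v\in V_2\setminus F,\end{cases}$$ until $I^{k+1}=I^k$; whenever $I^{k+1}(v)\neq I^k(v)$ for a $v\in V_1\setminus F$, it also records a successor $u$ that yields the new profile, together with the profile in $I^k(u)$. **Theorem.** There is a constant $C$ such that the following holds for every $d$-weighted reachability game. 1. Each $I^k(v)$ is a singleton $\{\mathbf x^k(v)\}$, and for $v\notin F$ the update is a lexicographic minimum or maximum over the successors: $\mathbf x^{k+1}(v)=\min_{\le_L}\{\mathbf x^k(u)+\mathbf w(v,u)\mid (v,u)\in E\}$ if $v\in V_1$, and $\mathbf x^{k+1}(v)=\max_{\le_L}\{\mathbf x^k(u)+\mathbf w(v,u)\mid (v,u)\in E\}$ if $v\in V_2$. 2. Implemented with these minima and maxima as a fixed program (the same for all games) on a random access machine over $\mathbb N\cup\{\infty\}$, whose elementary operations (memory accesses, assignments, additions, comparisons) have unit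 cost, the fixpoint algorithm halts after at most $C\cdot|V|^3\cdot d$ steps. Its result is a profile $\mathbf x(v)$ for each $v\in V$ such that the upper value from $v$ is exactly $\{\mathbf x(v)\}$. Moreover there is $k\le|V|$ with $I^{k+1}(v)=I^k(v)=\{\mathbf x(v)\}$ for all $v\in V$. In particular, the upper value is computed in time $O(|V|^3\cdot d)$, polynomial in $|V|$ and $d$. -/

import Mathlib

namespace MultiReach

/-! ### Multi-weighted reachability games -/

/-- Cost profiles: `d`-tuples over `ℕ ∪ {∞}`. The order `≤` on this type is the lexicographic order
(with the coordinate of index `0` compared first), and addition is componentwise. -/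
abbrev Profile (d : ℕ) : Type := Lex (Fin d → ℕ∞)

/-- The profile `(∞, …, ∞)`. -/
def infProfile (d : ℕ) : Profile d := toLex fun _ => ⊤

/-- A `d`-weighted reachability game on the vertex set `V`. Player 1 owns the vertices of `V₁` and
player 2 owns the other ones. Only the weights of edges matter: `weight v u` is used nowhere unless
`Edge v u` holds. Plays are infinite and strategies always have a legal move, so every vertex has a
successor. -/
structure Game (V : Type*) (d : ℕ) where
  V₁ : Set V
  Edge : V → V → Prop
  weight : V → V → Fin d → ℕ
  target : Set V
  total : ∀ v, ∃ u, Edge v u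

/-- Minimal elements of a set of cost profiles. -/
def minimalElements {d : ℕ} (X : Set (Profile d)) : Set (Profile d) :=
  {x | Minimal (fun y => y ∈ X) x}

/-- Upward closure of a set of cost profiles. -/
def upClosure {d : ℕ} (X : Set (Profile d)) : Set (Profile d) :=
  {x | ∃ y ∈ X, y ≤ x}

namespace Game

variable {V : Type*} {d : ℕ} (G : Game V d)

/-- The weight of the edge `(v, u)` as a cost profile. -/
def weightProfile (v u : V) : Profile d := toLex fun i => (G.weight v u i : ℕ∞)

/-- The histories starting in `v`. -/
def IsHistory (v : V) (h : List V) : Prop :=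
  h.head? = some v ∧ h.IsChain G.Edge

/-- The strategies, from `v`, of the player who owns the vertices of `P`. Only the values on
histories that start in `v` and end in `P` matter. -/
def strategies (P : Set V) (v : V) : Set (List V → V) :=
  {σ | ∀ h u, G.IsHistory v h → h.getLast? = some u → u ∈ P → G.Edge u (σ h)}

open Classical in
/-- The history formed by the first `k + 1` vertices of the outcome of `(σ₁, σ₂)` from `v`. -/
noncomputable def outcomeHistory (σ₁ σ₂ : List V → V) (v : V) : ℕ → List V
  | 0 => [v]
  | k + 1 =>
      let h := outcomeHistory σ₁ σ₂ v k
      h ++ [if h.getLastD v ∈ G.V₁ then σ₁ h else σ₂ h]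

/-- The outcome of `(σ₁, σ₂)` from `v`. -/
noncomputable def outcome (σ₁ σ₂ : List V → V) (v : V) (k : ℕ) : V :=
  (G.outcomeHistory σ₁ σ₂ v k).getLastD v

open Classical in
/-- The cost profile of a play: the accumulated weights up to the first visit of the target set, and
`(∞, …, ∞)` if the target set is never visited. -/
noncomputable def cost (ρ : ℕ → V) : Profile d :=
  if h : ∃ l, ρ l ∈ G.target then
    ∑ m ∈ Finset.range (Nat.find h), G.weightProfile (ρ m) (ρ (m + 1))
  else infProfile d

/-- The cost profiles that player 1 can ensure from `v`, for the lexicographic order. -/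
def ensured (v : V) : Set (Profile d) :=
  {x | ∃ σ₁ ∈ G.strategies G.V₁ v, ∀ σ₂ ∈ G.strategies G.V₁ᶜ v,
    G.cost (G.outcome σ₁ σ₂ v) ≤ x}

/-- The upper value from `v`, as the set of minimal ensured cost profiles. -/
def upperValue (v : V) : Set (Profile d) := minimalElements (G.ensured v)

open Classical in
/-- The sets `I^k(v)` of the fixpoint algorithm. -/
noncomputable def iter : ℕ → V → Set (Profile d)
  | 0, v => if v ∈ G.target then {0} else {infProfile d}
  | k + 1, v =>
      if v ∈ G.target then {0}
      else if v ∈ G.V₁ then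
        minimalElements (⋃ u ∈ {u | G.Edge v u},
          upClosure ((fun x => x + G.weightProfile v u) '' iter k u))
      else
        minimalElements (⋂ u ∈ {u | G.Edge v u},
          upClosure ((fun x => x + G.weightProfile v u) '' iter k u))

end Game

/-! ### A random access machine with a step count

Structured programs over finitely many registers and arrays whose cells hold elements of
`ℕ ∪ {∞}`. The only arithmetic operation is addition (there is no multiplication), the only tests
are comparisons of two numbers. Every constant, register access, array index, array access,
addition, comparison, test, assignment and empty instruction counts as one step. -/

/-- Registers: the inputs `n = |V|` and `d`; loop counters `v`, `u`, `i`; the outcome `cmp` of a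
comparison of profiles; the best successor found so far; the flag that controls the main loop. -/
inductive Reg
  | n | d | v | u | i | cmp | best | changed
  deriving DecidableEq

/-- Arrays: the input arrays `edge`, `weight`, `owner`, `target`; the arrays `old` and `cur` for
`I^k` and `I^(k+1)`; the arrays `succ` and `rest` for the two components of the strategy tables
`f_v`. -/
inductive Arr
  | edge | weight | owner | target | old | cur | succ | rest
  deriving DecidableEq

/-- Memory contents. Arrays are addressed by finite sequences of numbers. -/
structure Store where
  reg : Reg → ℕ∞
  arr : Arr → List ℕ∞ → ℕ∞

namespace Store

def setReg (s : Store) (r : Reg) (x : ℕ∞) : Store :=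
  { s with reg := Function.update s.reg r x }

def setArr (s : Store) (a : Arr) (p : List ℕ∞) (x : ℕ∞) : Store :=
  { s with arr := Function.update s.arr a (Function.update (s.arr a) p x) }

end Store

/-- Expressions. `cell a rs` is the cell of the array `a` whose address is held by the registers
`rs`. -/
inductive Exp
  | const (c : ℕ∞)
  | reg (r : Reg)
  | cell (a : Arr) (rs : List Reg)
  | add (e f : Exp)

namespace Exp

def eval (s : Store) : Exp → ℕ∞
  | const c => c
  | reg r => s.reg r
  | cell a rs => s.arr a (rs.map s.reg)
  | add e f => e.eval s + f.eval s

/-- Number of steps of the evaluation. -/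
def steps : Exp → ℕ
  | const _ => 1
  | reg _ => 1
  | cell _ rs => rs.length + 1
  | add e f => e.steps + f.steps + 1

end Exp

/-- Tests. -/
inductive Test
  | lt (e f : Exp)
  | eq (e f : Exp)

namespace Test

def holds (s : Store) : Test → Prop
  | lt e f => e.eval s < f.eval s
  | eq e f => e.eval s = f.eval s

/-- Number of steps of the evaluation. -/
def steps : Test → ℕ
  | lt e f => e.steps + f.steps + 1
  | eq e f => e.steps + f.steps + 1

end Test

/-- Programs. `setReg r e` is `r := e`, `setCell a rs e` is `a[rs] := e`, `branch b c c'` is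
`if b then c else c'`, and `loop b c` is `while b do c`. -/
inductive Cmd
  | skip
  | setReg (r : Reg) (e : Exp)
  | setCell (a : Arr) (rs : List Reg) (e : Exp)
  | seq (c c' : Cmd)
  | branch (b : Test) (c c' : Cmd)
  | loop (b : Test) (c : Cmd)

/-- `Exec c s t s'`: the program `c`, started on the memory contents `s`, halts after exactly `t`
steps with the memory contents `s'`. -/
inductive Exec : Cmd → Store → ℕ → Store → Prop
  | skip (s : Store) : Exec .skip s 1 s
  | setReg (s : Store) (r : Reg) (e : Exp) :
      Exec (.setReg r e) s (e.steps + 1) (s.setReg r (e.eval s))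
  | setCell (s : Store) (a : Arr) (rs : List Reg) (e : Exp) :
      Exec (.setCell a rs e) s (rs.length + e.steps + 1)
        (s.setArr a (rs.map s.reg) (e.eval s))
  | seq {c c' : Cmd} {s s' s'' : Store} {t t' : ℕ} :
      Exec c s t s' → Exec c' s' t' s'' → Exec (.seq c c') s (t + t') s''
  | branchTrue {b : Test} {c c' : Cmd} {s s' : Store} {t : ℕ} :
      b.holds s → Exec c s t s' → Exec (.branch b c c') s (b.steps + 1 + t) s'
  | branchFalse {b : Test} {c c' : Cmd} {s s' : Store} {t : ℕ} :
      ¬ b.holds s → Exec c' s t s' → Exec (.branch b c c') s (b.steps + 1 + t) s'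
  | loopTrue {b : Test} {c : Cmd} {s s' s'' : Store} {t t' : ℕ} :
      b.holds s → Exec c s t s' → Exec (.loop b c) s' t' s'' →
      Exec (.loop b c) s (b.steps + 1 + t + t') s''
  | loopFalse {b : Test} {c : Cmd} {s : Store} :
      ¬ b.holds s → Exec (.loop b c) s (b.steps + 1) s

namespace Cmd

/-- Sequential composition of a list of programs. -/
def block : List Cmd → Cmd
  | [] => skip
  | c :: cs => seq c (block cs)

/-- `for r = 0, …, m - 1 do c`, where `m` is the content of the register `bound`. -/
def forLoop (r bound : Reg) (c : Cmd) : Cmd :=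
  block [setReg r (.const 0),
    loop (.lt (.reg r) (.reg bound)) (block [c, setReg r (.add (.reg r) (.const 1))])]

/-- `if b then c`. -/
def when (b : Test) (c : Cmd) : Cmd := branch b c skip

/-- `if b then skip else c`. -/
def whenNot (b : Test) (c : Cmd) : Cmd := branch b skip c

end Cmd

/-! ### The fixpoint algorithm for the lexicographic order

Each set `I^k(v)` is stored as one cost profile. -/

namespace Alg

open Cmd

/-- The `i`-th component of `I^k(u) + w(v, u)`. -/
def candidate : Exp := .add (.cell .old [.u, .i]) (.cell .weight [.v, .u, .i])

/-- All components of `cur[v]` are set to `c`. -/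
def fill (c : ℕ∞) : Cmd := forLoop .i .d (setCell .cur [.v, .i] (.const c))

/-- Lexicographic comparison of `I^k(u) + w(v, u)` with `cur[v]`: `cmp` becomes `1` if the former
is smaller, `2` if it is larger and `0` if they are equal. -/
def compare : Cmd := block [
  setReg .cmp (.const 0),
  forLoop .i .d (when (.eq (.reg .cmp) (.const 0))
    (branch (.lt candidate (.cell .cur [.v, .i]))
      (setReg .cmp (.const 1))
      (when (.lt (.cell .cur [.v, .i]) candidate) (setReg .cmp (.const 2)))))]

/-- `cur[v] := I^k(u) + w(v, u)`, and `u` is recorded. -/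
def take : Cmd := block [
  setReg .best (.reg .u),
  forLoop .i .d (setCell .cur [.v, .i] candidate)]

/-- `cur[v]` becomes the minimum (for `r = 1`) or the maximum (for `r = 2`) of its present value and
of the profiles `I^k(u) + w(v, u)`, for the successors `u` of `v`. -/
def scan (r : ℕ∞) : Cmd :=
  forLoop .u .n (when (.eq (.cell .edge [.v, .u]) (.const 1))
    (block [compare, when (.eq (.reg .cmp) (.const r)) take]))

/-- If `cur[v]` differs from `old[v]`, then the strategy table at `v` receives the successor that
yields the minimum, together with the profile of this successor. -/
def updateStrategy : Cmd := block [
  setReg .cmp (.const 0),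
  forLoop .i .d
    (whenNot (.eq (.cell .cur [.v, .i]) (.cell .old [.v, .i])) (setReg .cmp (.const 1))),
  when (.eq (.reg .cmp) (.const 1)) (block [
    setCell .succ [.v] (.reg .best),
    forLoop .i .d (setCell .rest [.v, .i] (.cell .old [.best, .i]))])]

/-- Computation of `I^(k+1)(v)`, in `cur[v]`, from `I^k`, in `old`. -/
def update : Cmd :=
  branch (.eq (.cell .target [.v]) (.const 1))
    (fill 0)
    (branch (.eq (.cell .owner [.v]) (.const 1))
      (block [fill ⊤, scan 1, updateStrategy])
      (block [fill 0, scan 2]))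

/-- Computation of `I^0`, in `cur`. -/
def init : Cmd :=
  forLoop .v .n (branch (.eq (.cell .target [.v]) (.const 1)) (fill 0) (fill ⊤))

/-- One pass of the main loop; `changed` becomes `1` if `I^(k+1)` differs from `I^k`, and `0` if
not. -/
def pass : Cmd := block [
  forLoop .v .n (forLoop .i .d (setCell .old [.v, .i] (.cell .cur [.v, .i]))),
  forLoop .v .n update,
  setReg .changed (.const 0),
  forLoop .v .n (forLoop .i .d
    (whenNot (.eq (.cell .cur [.v, .i]) (.cell .old [.v, .i])) (setReg .changed (.const 1))))]

/-- The fixpoint algorithm: passes are made until one changes nothing. -/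
def fixpoint : Cmd :=
  block [init, pass, loop (.eq (.reg .changed) (.const 1)) pass]

end Alg

open Classical in
/-- The memory contents `s` hold the game `G` as input, its vertices being numbered by `num`.
Nothing is required of the working memory. -/
structure Encodes {V : Type*} [Fintype V] {d : ℕ} (G : Game V d)
    (num : V ≃ Fin (Fintype.card V)) (s : Store) : Prop where
  size : s.reg .n = (Fintype.card V : ℕ∞)
  dim : s.reg .d = (d : ℕ∞)
  edge : ∀ v u, s.arr .edge [((num v : ℕ) : ℕ∞), ((num u : ℕ) : ℕ∞)] =
    if G.Edge v u then 1 else 0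
  weight : ∀ v u, G.Edge v u → ∀ i : Fin d,
    s.arr .weight [((num v : ℕ) : ℕ∞), ((num u : ℕ) : ℕ∞), ((i : ℕ) : ℕ∞)] =
      (G.weight v u i : ℕ∞)
  owner : ∀ v, s.arr .owner [((num v : ℕ) : ℕ∞)] = if v ∈ G.V₁ then 1 else 2
  target : ∀ v, s.arr .target [((num v : ℕ) : ℕ∞)] = if v ∈ G.target then 1 else 0

/-- The cost profile that the memory contents `s` hold, as a result, for the vertex `v`. -/
def output {V : Type*} [Fintype V] (d : ℕ) (num : V ≃ Fin (Fintype.card V)) (s : Store) (v : V) :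
    Profile d :=
  toLex fun i : Fin d => s.arr .cur [((num v : ℕ) : ℕ∞), ((i : ℕ) : ℕ∞)]

end MultiReach

/-! The lexicographic order is total, so an up-closed set generated by one profile per successor
again has a least element after a finite union (the minimum) or intersection (the maximum). The
fixpoint algorithm is therefore value iteration on single profiles, recorded here by the relation
`IsUpdate`. Adding a finite weight profile is monotone and never decreases a profile, so one update
is a monotone operator and the iterates descend from their initial value.

Stabilisation within `|V|` rounds is a Dijkstra-like argument (`exists_stable_ssuperset`). Let `S`
contain the target and be stable from index `j` on. Among all values ever taken outside `S` there is
a least one `l`, since the order is well-founded; let `v` attain it as early as possible. Before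
that index every value outside `S` is strictly above `l`, so the successors that justify the value
`l` at `v` lie in `S`. They have their final values at index `j`, and `v` has its final value at `j
+ 1`. Thus at least one vertex is settled per round. Zero weights do no harm, because strictness
comes from the earliest index and not from the weights.

The stable iterate is the upper value by two bounds. Every iterate `val k v` is ensured, by playing
for `k` rounds the move that is optimal for the remaining horizon (`val_mem_ensured`). Conversely,
every fixpoint of the update bounds the ensured profiles from below, since player 2 can always move
to a maximising successor (`le_of_mem_ensured`).

For the running time, `Runs` serves as a Hoare logic with step bounds, and `Frame` gives what a
program leaves untouched. One pass performs `IsUpdate` in `O(|V|² d)` steps (`runs_pass`);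
stabilisation allows at most `|V| + 1` passes (`runs_loop_pass`). -/

namespace MultiReach

/-! ### The lexicographic order on cost profiles -/

section Profile

variable {d : ℕ}

theorem Profile.lt_iff {x y : Profile d} : x < y ↔ ∃ i, (∀ j < i, x j = y j) ∧ x i < y i :=
  Iff.rfl

theorem le_infProfile (x : Profile d) : x ≤ infProfile d :=
  Pi.toLex_monotone (fun _ => le_top : ofLex x ≤ fun _ => ⊤)

theorem Profile.zero_le (x : Profile d) : 0 ≤ x :=
  Pi.toLex_monotone (fun _ => _root_.zero_le : (0 : Fin d → ℕ∞) ≤ ofLex x)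

theorem Profile.le_add_right (x y : Profile d) : x ≤ x + y :=
  Pi.toLex_monotone (fun _ => le_self_add : ofLex x ≤ ofLex x + ofLex y)

theorem infProfile_add (x : Profile d) : infProfile d + x = infProfile d :=
  funext fun _ => top_add _

namespace Game

variable {V : Type*} (G : Game V d)

/-- The first coordinate where the profiles differ stays the first one, and the strict inequality
there survives because the weight is finite; adding `∞` would destroy it. -/
theorem add_weightProfile_lt_add_weightProfile {x y : Profile d} (h : x < y) (v u : V) :
    x + G.weightProfile v u < y + G.weightProfile v u := by
  obtain ⟨i, hi, hlt⟩ := Profile.lt_iff.1 h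
  exact Profile.lt_iff.2 ⟨i, fun j hj => congrArg (· + (G.weight v u j : ℕ∞)) (hi j hj),
    (ENat.add_lt_add_iff_right (ENat.natCast_ne_top _)).2 hlt⟩

theorem add_weightProfile_le_add_weightProfile {x y : Profile d} (h : x ≤ y) (v u : V) :
    x + G.weightProfile v u ≤ y + G.weightProfile v u := by
  rcases h.eq_or_lt with rfl | h
  · exact le_rfl
  · exact (G.add_weightProfile_lt_add_weightProfile h v u).le

end Game

end Profile

/-! ### The iterates as single profiles -/

namespace Game

variable {V : Type*} {d : ℕ} (G : Game V d)

/-- The profiles `f u + w(v, u)` for the successors `u` of `v`. -/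
def candidates (f : V → Profile d) (v : V) : Set (Profile d) :=
  {x | ∃ u, G.Edge v u ∧ x = f u + G.weightProfile v u}

theorem candidates_nonempty (f : V → Profile d) (v : V) : (G.candidates f v).Nonempty :=
  let ⟨u, hu⟩ := G.total v
  ⟨_, u, hu, rfl⟩

theorem candidates_finite [Finite V] (f : V → Profile d) (v : V) : (G.candidates f v).Finite :=
  (Set.finite_range fun u => f u + G.weightProfile v u).subset
    fun _ ⟨u, _, h⟩ => ⟨u, h.symm⟩

theorem exists_isLeast_candidates [Finite V] (f : V → Profile d) (v : V) :
    ∃ x, IsLeast (G.candidates f v) x := by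
  obtain ⟨x, hx, h⟩ := (G.candidates f v).exists_min_image id (G.candidates_finite f v)
    (G.candidates_nonempty f v)
  exact ⟨x, hx, h⟩

theorem exists_isGreatest_candidates [Finite V] (f : V → Profile d) (v : V) :
    ∃ x, IsGreatest (G.candidates f v) x := by
  obtain ⟨x, hx, h⟩ := (G.candidates f v).exists_max_image id (G.candidates_finite f v)
    (G.candidates_nonempty f v)
  exact ⟨x, hx, h⟩

/-- `f'` arises from `f` by one update at every vertex. -/
structure IsUpdate (f f' : V → Profile d) : Prop where
  target : ∀ v ∈ G.target, f' v = 0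
  isLeast : ∀ v ∉ G.target, v ∈ G.V₁ → IsLeast (G.candidates f v) (f' v)
  isGreatest : ∀ v ∉ G.target, v ∉ G.V₁ → IsGreatest (G.candidates f v) (f' v)

theorem exists_isUpdate [Finite V] (f : V → Profile d) : ∃ f', G.IsUpdate f f' := by
  choose a ha using G.exists_isLeast_candidates f
  choose b hb using G.exists_isGreatest_candidates f
  classical
  refine ⟨fun v => if v ∈ G.target then 0 else if v ∈ G.V₁ then a v else b v, ?_, ?_, ?_⟩
  · intro v hv
    simp [hv]
  · intro v hv hv₁
    simpa [hv, hv₁] using ha v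
  · intro v hv hv₁
    simpa [hv, hv₁] using hb v

variable {G} in
-- Lets the contents of memory after a pass be identified with the next iterate, and makes the
-- choice in the definition of `val` harmless.
theorem IsUpdate.unique {f f' f'' : V → Profile d} (h' : G.IsUpdate f f')
    (h'' : G.IsUpdate f f'') : f' = f'' := by
  funext v
  by_cases hv : v ∈ G.target
  · rw [h'.target v hv, h''.target v hv]
  by_cases hv₁ : v ∈ G.V₁
  · exact (h'.isLeast v hv hv₁).unique (h''.isLeast v hv hv₁)
  · exact (h'.isGreatest v hv hv₁).unique (h''.isGreatest v hv hv₁)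

variable {G} in
theorem IsUpdate.mono {f f' g g' : V → Profile d} (hf : G.IsUpdate f f') (hg : G.IsUpdate g g')
    (h : ∀ v, f v ≤ g v) (v : V) : f' v ≤ g' v := by
  by_cases hv : v ∈ G.target
  · rw [hf.target v hv, hg.target v hv]
  by_cases hv₁ : v ∈ G.V₁
  · obtain ⟨u, hu, hgu⟩ := (hg.isLeast v hv hv₁).1
    rw [hgu]
    exact ((hf.isLeast v hv hv₁).2 ⟨u, hu, rfl⟩).trans
      (G.add_weightProfile_le_add_weightProfile (h u) v u)
  · obtain ⟨u, hu, hfu⟩ := (hf.isGreatest v hv hv₁).1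
    rw [hfu]
    exact (G.add_weightProfile_le_add_weightProfile (h u) v u).trans
      ((hg.isGreatest v hv hv₁).2 ⟨u, hu, rfl⟩)

open Classical in
/-- The profile in `I^k(v)`. -/
noncomputable def val [Finite V] : ℕ → V → Profile d
  | 0, v => if v ∈ G.target then 0 else infProfile d
  | k + 1, v => (G.exists_isUpdate (val k)).choose v

theorem isUpdate_val [Finite V] (k : ℕ) : G.IsUpdate (G.val k) (G.val (k + 1)) :=
  (G.exists_isUpdate (G.val k)).choose_spec

theorem val_of_mem_target [Finite V] (k : ℕ) {v : V} (hv : v ∈ G.target) : G.val k v = 0 := by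
  cases k with
  | zero => simp [val, hv]
  | succ k => exact (G.isUpdate_val k).target v hv

theorem val_zero_of_notMem_target [Finite V] {v : V} (hv : v ∉ G.target) :
    G.val 0 v = infProfile d := by
  simp [val, hv]

theorem mem_upClosure_image_singleton {x y z : Profile d} :
    x ∈ upClosure ((fun x => x + z) '' {y}) ↔ y + z ≤ x := by
  simp [upClosure]

theorem minimalElements_eq_singleton {X : Set (Profile d)} {m : Profile d} (h : IsLeast X m) :
    minimalElements X = {m} := by
  ext x
  constructor
  · intro hx
    exact le_antisymm (hx.2 h.1 (h.2 hx.1)) (h.2 hx.1)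
  · rintro rfl
    exact ⟨h.1, fun y hy _ => h.2 hy⟩

/-- In a total order, membership in the union of principal up-sets means lying above the least
generator, and membership in the intersection means lying above the greatest one. -/
theorem iter_eq_singleton_val [Finite V] (k : ℕ) (v : V) : G.iter k v = {G.val k v} := by
  induction k generalizing v with
  | zero => simp only [iter, val]; split_ifs <;> rfl
  | succ k ih =>
    by_cases hv : v ∈ G.target
    · simp [iter, hv, G.val_of_mem_target]
    by_cases hv₁ : v ∈ G.V₁
    · simp only [iter, hv, hv₁, if_false, if_true, ih]
      obtain ⟨⟨u, hu, hm⟩, hle⟩ := (G.isUpdate_val k).isLeast v hv hv₁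
      refine minimalElements_eq_singleton ⟨?_, ?_⟩
      · exact Set.mem_biUnion hu (mem_upClosure_image_singleton.2 hm.ge)
      · intro x hx
        obtain ⟨u', hu', hx⟩ := Set.mem_iUnion₂.1 hx
        exact (hle ⟨u', hu', rfl⟩).trans (mem_upClosure_image_singleton.1 hx)
    · simp only [iter, hv, hv₁, if_false, ih]
      obtain ⟨⟨u, hu, hm⟩, hle⟩ := (G.isUpdate_val k).isGreatest v hv hv₁
      refine minimalElements_eq_singleton ⟨?_, ?_⟩
      · exact Set.mem_iInter₂.2 fun u' hu' =>
          mem_upClosure_image_singleton.2 (hle ⟨u', hu', rfl⟩)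
      · intro x hx
        rw [hm]
        exact mem_upClosure_image_singleton.1 (Set.mem_iInter₂.1 hx u hu)

/-! ### Stabilisation after at most `|V|` updates -/

/-- The first update starts from the largest possible profile off the target, so it can only
decrease; monotonicity of the update propagates this to all later rounds. -/
theorem val_succ_le [Finite V] (k : ℕ) (v : V) : G.val (k + 1) v ≤ G.val k v := by
  induction k generalizing v with
  | zero =>
    by_cases hv : v ∈ G.target
    · simp [val_of_mem_target, hv]
    · rw [G.val_zero_of_notMem_target hv]
      exact le_infProfile _
  | succ k ih => exact (G.isUpdate_val (k + 1)).mono (G.isUpdate_val k) ih v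

theorem antitone_val [Finite V] (v : V) : Antitone fun k => G.val k v :=
  antitone_nat_of_succ_le fun k => G.val_succ_le k v

/-- If the profiles on `S` are stable from index `j` on, then one further update makes them stable
on a larger set. -/
theorem exists_stable_ssuperset [Finite V] {S : Set V} {j : ℕ} (hS : G.target ⊆ S)
    (hne : S ≠ Set.univ) (hstable : ∀ v ∈ S, ∀ m ≥ j, G.val m v = G.val j v) :
    ∃ T, S ⊂ T ∧ ∀ v ∈ T, ∀ m ≥ j + 1, G.val m v = G.val (j + 1) v := by
  obtain ⟨v₀, hv₀⟩ := (Set.ne_univ_iff_exists_notMem S).1 hne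
  have hle : ∀ v ∈ S, ∀ m, G.val j v ≤ G.val m v := fun v hv m => by
    rcases le_total j m with h | h
    · exact (hstable v hv m h).ge
    · exact G.antitone_val v h
  let X : Set (Profile d) := {x | ∃ v ∉ S, ∃ m, G.val m v = x}
  have hX : X.Nonempty := ⟨_, v₀, hv₀, 0, rfl⟩
  -- The lexicographic order on finitely many copies of `ℕ∞` is well-founded, so the infinitely many
  -- values outside `S` have a least one.
  let l : Profile d := wellFounded_lt.min X hX
  have hl : ∀ v ∉ S, ∀ m, l ≤ G.val m v := fun v hv m =>
    not_lt.1 (wellFounded_lt.not_lt_min X ⟨v, hv, m, rfl⟩)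
  have hex : ∃ m, ∃ v ∉ S, G.val m v = l := by
    obtain ⟨v, hv, m, h⟩ := wellFounded_lt.min_mem X hX
    exact ⟨m, v, hv, h⟩
  classical
  obtain ⟨v, hv, hm⟩ := Nat.find_spec hex
  have hvF : v ∉ G.target := fun h => hv (hS h)
  -- Strictness comes from the choice of the earliest index at which `l` is attained outside `S`.
  have hmin : ∀ m < Nat.find hex, ∀ u ∉ S, l < G.val m u := fun m hm u hu =>
    (hl u hu m).lt_of_ne fun h => Nat.find_min hex hm ⟨u, hu, h.symm⟩
  generalize Nat.find hex = m at hm hmin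
  cases m with
  | zero =>
    -- If the least value is already attained at index `0`, it is `(∞, …, ∞)`; then all values
    -- outside `S` are constantly infinite and every vertex is stable.
    have hinf : l = infProfile d := hm.symm.trans (G.val_zero_of_notMem_target hvF)
    refine ⟨Set.univ, Set.ssubset_univ_iff.2 hne, fun u _ m hmj => ?_⟩
    by_cases hu : u ∈ S
    · rw [hstable u hu m (by omega), hstable u hu (j + 1) (by omega)]
    · exact ((le_infProfile _).antisymm (hinf ▸ hl u hu m)).trans
        ((le_infProfile _).antisymm (hinf ▸ hl u hu (j + 1))).symm
  | succ m =>
    have hvj : G.val (j + 1) v ≤ l := by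
      -- A successor whose candidate at index `m` is at most `l` cannot lie outside `S`, where
      -- values at index `m` exceed `l`. Inside `S` the value at `j` is the least ever taken, so the
      -- bound transfers from `m` to `j`.
      have hsucc : ∀ u, G.val m u + G.weightProfile v u ≤ l →
          G.val j u + G.weightProfile v u ≤ l := fun u hu => by
        refine (G.add_weightProfile_le_add_weightProfile (hle u ?_ m) v u).trans hu
        by_contra huS
        exact ((hmin m (by omega) u huS).trans_le (Profile.le_add_right _ _)).not_ge hu
      by_cases hv₁ : v ∈ G.V₁
      · obtain ⟨u, hu, hum⟩ := ((G.isUpdate_val m).isLeast v hvF hv₁).1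
        exact (((G.isUpdate_val j).isLeast v hvF hv₁).2 ⟨u, hu, rfl⟩).trans
          (hsucc u (hum.symm.trans hm).le)
      · obtain ⟨u, hu, huj⟩ := ((G.isUpdate_val j).isGreatest v hvF hv₁).1
        rw [huj]
        exact hsucc u ((((G.isUpdate_val m).isGreatest v hvF hv₁).2 ⟨u, hu, rfl⟩).trans hm.le)
    refine ⟨insert v S, Set.ssubset_insert hv, ?_⟩
    rintro u (rfl | hu) m' hm'
    · exact ((G.antitone_val u hm').trans hvj).antisymm (hl u hv m') |>.trans
        (hvj.antisymm (hl u hv _)).symm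
    · rw [hstable u hu m' (by omega), hstable u hu (j + 1) (by omega)]

/-- The target is stable from the start, and each further round enlarges the stable set by at least
one vertex until it is everything. -/
theorem exists_stable_set [Finite V] (j : ℕ) : ∃ S : Set V, G.target ⊆ S ∧
    (S = Set.univ ∨ j ≤ S.ncard) ∧ ∀ v ∈ S, ∀ m ≥ j, G.val m v = G.val j v := by
  induction j with
  | zero => exact ⟨G.target, subset_rfl, Or.inr (Nat.zero_le _), fun v hv m _ => by
      rw [G.val_of_mem_target m hv, G.val_of_mem_target 0 hv]⟩
  | succ j ih =>
    obtain ⟨S, hS, hcard, hstable⟩ := ih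
    by_cases hne : S = Set.univ
    · refine ⟨S, hS, Or.inl hne, fun v hv m hm => ?_⟩
      rw [hstable v hv m (by omega), hstable v hv (j + 1) (by omega)]
    · obtain ⟨T, hT, h⟩ := G.exists_stable_ssuperset hS hne hstable
      have := Set.ncard_lt_ncard hT T.toFinite
      exact ⟨T, hS.trans hT.subset, Or.inr (by have := hcard.resolve_left hne; omega), h⟩

theorem val_eq_val_card [Fintype V] {m : ℕ} (hm : Fintype.card V ≤ m) :
    G.val m = G.val (Fintype.card V) := by
  obtain ⟨S, -, hS, h⟩ := G.exists_stable_set (Fintype.card V)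
  have hS : S = Set.univ := hS.elim id fun hc =>
    Set.eq_of_subset_of_ncard_le (Set.subset_univ S)
      (by rwa [Set.ncard_univ, Nat.card_eq_fintype_card])
  exact funext fun v => h v (hS ▸ Set.mem_univ v) m hm

/-! ### The upper value -/

theorem cost_of_mem_target {ρ : ℕ → V} (h : ρ 0 ∈ G.target) : G.cost ρ = 0 := by
  classical
  have hex : ∃ l, ρ l ∈ G.target := ⟨0, h⟩
  rw [cost, dif_pos hex]
  have : Nat.find hex = 0 := (Nat.find_eq_zero hex).2 h
  convert Finset.sum_range_zero _

/-- The first visit happens one index earlier on the shifted play, so the first edge splits off the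
sum; without a visit both sides are `(∞, …, ∞)`, which absorbs the weight. -/
theorem cost_of_notMem_target {ρ : ℕ → V} (h : ρ 0 ∉ G.target) :
    G.cost ρ = G.cost (fun m => ρ (m + 1)) + G.weightProfile (ρ 0) (ρ 1) := by
  classical
  by_cases hex : ∃ l, ρ (l + 1) ∈ G.target
  · have hex' : ∃ l, ρ l ∈ G.target := let ⟨l, hl⟩ := hex; ⟨l + 1, hl⟩
    rw [cost, cost, dif_pos hex, dif_pos hex', ← Finset.sum_range_succ' (fun m =>
      G.weightProfile (ρ m) (ρ (m + 1)))]
    congr 2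
    convert Nat.find_comp_succ hex' hex h
  · have hex' : ¬ ∃ l, ρ l ∈ G.target := by
      rintro ⟨_ | l, hl⟩
      exacts [h hl, hex ⟨l, hl⟩]
    rw [cost, cost, dif_neg hex, dif_neg hex', infProfile_add]

/-- Induction on the horizon `k`. Only moves of player 1 must be optimal: any move of player 2 is
bounded by the maximum. When the horizon is exhausted off the target, the bound is infinite. -/
theorem cost_le_val [Finite V] (k : ℕ) (ρ : ℕ → V) (hρ : ∀ m, G.Edge (ρ m) (ρ (m + 1)))
    (hopt : ∀ l m, l + m + 1 = k → ρ l ∉ G.target → ρ l ∈ G.V₁ →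
      G.val (m + 1) (ρ l) = G.val m (ρ (l + 1)) + G.weightProfile (ρ l) (ρ (l + 1))) :
    G.cost ρ ≤ G.val k (ρ 0) := by
  by_cases h0 : ρ 0 ∈ G.target
  · rw [G.cost_of_mem_target h0]
    exact Profile.zero_le _
  induction k generalizing ρ with
  | zero =>
    rw [G.val_zero_of_notMem_target h0]
    exact le_infProfile _
  | succ k ih =>
    have hsucc : G.val k (ρ 1) + G.weightProfile (ρ 0) (ρ 1) ≤ G.val (k + 1) (ρ 0) := by
      by_cases h₁ : ρ 0 ∈ G.V₁
      · exact (hopt 0 k (by omega) h0 h₁).ge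
      · exact ((G.isUpdate_val k).isGreatest _ h0 h₁).2 ⟨_, hρ 0, rfl⟩
    rw [G.cost_of_notMem_target h0]
    refine (G.add_weightProfile_le_add_weightProfile ?_ _ _).trans hsucc
    by_cases h1 : ρ 1 ∈ G.target
    · rw [G.cost_of_mem_target h1]
      exact Profile.zero_le _
    · exact ih (fun m => ρ (m + 1)) (fun m => hρ (m + 1))
        (fun l m hlm => hopt (l + 1) m (by omega)) h1

/-- Here `f` acts as a potential: its inequalities telescope along the play back from the first
visit of the target, and a play that never gets there has infinite cost. -/
theorem le_cost (f : V → Profile d) (hf : ∀ v ∈ G.target, f v = 0) (ρ : ℕ → V)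
    (h : ∀ m, ρ m ∉ G.target →
      f (ρ m) ≤ f (ρ (m + 1)) + G.weightProfile (ρ m) (ρ (m + 1))) :
    f (ρ 0) ≤ G.cost ρ := by
  by_cases hex : ∃ l, ρ l ∈ G.target
  · obtain ⟨l, hl⟩ := hex
    induction l generalizing ρ with
    | zero => rw [hf _ hl]; exact Profile.zero_le _
    | succ l ih =>
      by_cases h0 : ρ 0 ∈ G.target
      · rw [hf _ h0]; exact Profile.zero_le _
      · rw [G.cost_of_notMem_target h0]
        exact (h 0 h0).trans (G.add_weightProfile_le_add_weightProfile
          (ih (fun m => ρ (m + 1)) (fun m => h (m + 1)) hl) _ _)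
  · rw [cost, dif_neg hex]
    exact le_infProfile _

/-! ### Outcomes of strategy pairs are legal plays -/

section Outcome

variable (σ₁ σ₂ : List V → V) (v : V)

theorem outcomeHistory_ne_nil (k : ℕ) : G.outcomeHistory σ₁ σ₂ v k ≠ [] := by
  cases k <;> simp [outcomeHistory]

theorem getLast?_outcomeHistory (k : ℕ) :
    (G.outcomeHistory σ₁ σ₂ v k).getLast? = some (G.outcome σ₁ σ₂ v k) := by
  rw [outcome, List.getLastD_eq_getLast?, List.getLast?_eq_getLast_of_ne_nil
    (G.outcomeHistory_ne_nil σ₁ σ₂ v k), Option.getD_some]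

theorem length_outcomeHistory (k : ℕ) : (G.outcomeHistory σ₁ σ₂ v k).length = k + 1 := by
  induction k with
  | zero => rfl
  | succ k ih => simp [outcomeHistory, ih]

open Classical in
theorem outcome_succ (k : ℕ) : G.outcome σ₁ σ₂ v (k + 1) =
    if G.outcome σ₁ σ₂ v k ∈ G.V₁ then σ₁ (G.outcomeHistory σ₁ σ₂ v k)
    else σ₂ (G.outcomeHistory σ₁ σ₂ v k) := by
  simp [outcome, outcomeHistory]

variable {σ₁ σ₂ v}

/-- Strategies are constrained only on genuine histories, so legality of the next move and validity
of the history must be proved together; this is the inductive step. -/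
theorem edge_outcome_of_isHistory (h₁ : σ₁ ∈ G.strategies G.V₁ v)
    (h₂ : σ₂ ∈ G.strategies G.V₁ᶜ v) {k : ℕ}
    (hk : G.IsHistory v (G.outcomeHistory σ₁ σ₂ v k)) :
    G.Edge (G.outcome σ₁ σ₂ v k) (G.outcome σ₁ σ₂ v (k + 1)) := by
  rw [outcome_succ]
  split_ifs with h
  · exact h₁ _ _ hk (G.getLast?_outcomeHistory ..) h
  · exact h₂ _ _ hk (G.getLast?_outcomeHistory ..) h

theorem isHistory_outcomeHistory (h₁ : σ₁ ∈ G.strategies G.V₁ v)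
    (h₂ : σ₂ ∈ G.strategies G.V₁ᶜ v) (k : ℕ) :
    G.IsHistory v (G.outcomeHistory σ₁ σ₂ v k) := by
  induction k with
  | zero => simp [IsHistory, outcomeHistory]
  | succ k ih =>
    have hedge := G.edge_outcome_of_isHistory h₁ h₂ ih
    have heq : G.outcomeHistory σ₁ σ₂ v (k + 1) =
        G.outcomeHistory σ₁ σ₂ v k ++ [G.outcome σ₁ σ₂ v (k + 1)] := by
      rw [outcome_succ]; rfl
    rw [heq]
    refine ⟨by rw [List.head?_append, ih.1]; rfl, ?_⟩
    rw [List.isChain_append]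
    refine ⟨ih.2, List.isChain_singleton _, ?_⟩
    intro x hx y hy
    rw [getLast?_outcomeHistory] at hx
    simp only [Option.mem_def, Option.some.injEq, List.head?_cons] at hx hy
    exact hx ▸ hy ▸ hedge

theorem edge_outcome (h₁ : σ₁ ∈ G.strategies G.V₁ v) (h₂ : σ₂ ∈ G.strategies G.V₁ᶜ v) (k : ℕ) :
    G.Edge (G.outcome σ₁ σ₂ v k) (G.outcome σ₁ σ₂ v (k + 1)) :=
  G.edge_outcome_of_isHistory h₁ h₂ (G.isHistory_outcomeHistory h₁ h₂ k)

end Outcome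

theorem val_mem_ensured [Finite V] (k : ℕ) (v : V) : G.val k v ∈ G.ensured v := by
  have hmove : ∀ (m : ℕ) (u : V), ∃ u', G.Edge u u' ∧ (u ∉ G.target → u ∈ G.V₁ →
      G.val (m + 1) u = G.val m u' + G.weightProfile u u') := fun m u => by
    by_cases h : u ∉ G.target ∧ u ∈ G.V₁
    · obtain ⟨u', hu', heq⟩ := ((G.isUpdate_val m).isLeast u h.1 h.2).1
      exact ⟨u', hu', fun _ _ => heq⟩
    · obtain ⟨u', hu'⟩ := G.total u
      exact ⟨u', hu', fun h' h'' => (h ⟨h', h''⟩).elim⟩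
  choose move hedge hopt using hmove
  -- A history of length `l + 1` has used `l` moves, which leaves horizon `k - l`; `move m` realises
  -- the value for horizon `m + 1`, hence `m = k - (l + 1)`. Beyond the horizon any legal move will
  -- do.
  let σ₁ : List V → V := fun h => move (k - h.length) (h.getLastD v)
  have hσ₁ : σ₁ ∈ G.strategies G.V₁ v := fun h u _ hlast _ => by
    have : h.getLastD v = u := by rw [List.getLastD_eq_getLast?, hlast, Option.getD_some]
    exact this ▸ hedge _ _
  refine ⟨σ₁, hσ₁, fun σ₂ hσ₂ => ?_⟩
  refine G.cost_le_val k _ (G.edge_outcome hσ₁ hσ₂) fun l m hlm hF h₁ => ?_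
  have : G.outcome σ₁ σ₂ v (l + 1) = move m (G.outcome σ₁ σ₂ v l) := by
    rw [outcome_succ, if_pos h₁]
    simp only [σ₁, length_outcomeHistory]
    rw [show k - (l + 1) = m by omega]
    rfl
  rw [this]
  exact hopt m _ hF h₁

/-- Against any strategy of player 1, player 2 answers positionally with a successor attaining the
maximum, which makes `f` a potential along the outcome. Fixpoints need not be unique; this bound
holds for each of them. -/
theorem le_of_mem_ensured {f : V → Profile d} (hf : G.IsUpdate f f) {v : V} {x : Profile d}
    (hx : x ∈ G.ensured v) : f v ≤ x := by
  have hmove : ∀ u : V, ∃ u', G.Edge u u' ∧ (u ∉ G.target → u ∉ G.V₁ →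
      f u = f u' + G.weightProfile u u') := fun u => by
    by_cases h : u ∉ G.target ∧ u ∉ G.V₁
    · obtain ⟨u', hu', heq⟩ := (hf.isGreatest u h.1 h.2).1
      exact ⟨u', hu', fun _ _ => heq⟩
    · obtain ⟨u', hu'⟩ := G.total u
      exact ⟨u', hu', fun h' h'' => (h ⟨h', h''⟩).elim⟩
  choose move hedge hopt using hmove
  obtain ⟨σ₁, hσ₁, hx⟩ := hx
  let σ₂ : List V → V := fun h => move (h.getLastD v)
  have hσ₂ : σ₂ ∈ G.strategies G.V₁ᶜ v := fun h u _ hlast _ => by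
    have : h.getLastD v = u := by rw [List.getLastD_eq_getLast?, hlast, Option.getD_some]
    exact this ▸ hedge _
  refine (G.le_cost f hf.target (G.outcome σ₁ σ₂ v) fun m hm => ?_).trans (hx σ₂ hσ₂)
  by_cases h₁ : G.outcome σ₁ σ₂ v m ∈ G.V₁
  · exact (hf.isLeast _ hm h₁).2 ⟨_, G.edge_outcome hσ₁ hσ₂ m, rfl⟩
  · have : G.outcome σ₁ σ₂ v (m + 1) = move (G.outcome σ₁ σ₂ v m) := by
      rw [outcome_succ, if_neg h₁]
      rfl
    rw [this]
    exact (hopt _ hm h₁).le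

theorem upperValue_eq_singleton_val [Finite V] {k : ℕ} (h : G.val (k + 1) = G.val k) (v : V) :
    G.upperValue v = {G.val k v} := by
  have hfix := G.isUpdate_val k
  rw [h] at hfix
  exact minimalElements_eq_singleton
    ⟨G.val_mem_ensured k v, fun _ hx => G.le_of_mem_ensured hfix hx⟩

end Game

/-! ### Memory that a program does not write to -/

namespace Cmd

/-- Does the program contain an assignment to the register? -/
def writesReg : Cmd → Reg → Bool
  | skip, _ => false
  | setReg r _, r' => decide (r = r')
  | setCell _ _ _, _ => false
  | seq c c', r => c.writesReg r || c'.writesReg r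
  | branch _ c c', r => c.writesReg r || c'.writesReg r
  | loop _ c, r => c.writesReg r

/-- Does the program contain an assignment to a cell of the array? -/
def writesArr : Cmd → Arr → Bool
  | skip, _ => false
  | setReg _ _, _ => false
  | setCell a _ _, a' => decide (a = a')
  | seq c c', a => c.writesArr a || c'.writesArr a
  | branch _ c c', a => c.writesArr a || c'.writesArr a
  | loop _ c, a => c.writesArr a

end Cmd

theorem Store.reg_setReg_of_ne {r r' : Reg} (h : r' ≠ r) (s : Store) (x : ℕ∞) :
    (s.setReg r x).reg r' = s.reg r' :=
  Function.update_of_ne h _ _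

theorem Store.reg_setReg_self (s : Store) (r : Reg) (x : ℕ∞) : (s.setReg r x).reg r = x :=
  Function.update_self ..

theorem Store.arr_setReg (s : Store) (r : Reg) (x : ℕ∞) : (s.setReg r x).arr = s.arr := rfl

theorem Store.arr_setArr_of_ne_arr {a a' : Arr} (h : a' ≠ a) (s : Store) (p : List ℕ∞) (x : ℕ∞) :
    (s.setArr a p x).arr a' = s.arr a' :=
  Function.update_of_ne h _ _

theorem Store.arr_setArr_self (s : Store) (a : Arr) (p : List ℕ∞) (x : ℕ∞) :
    (s.setArr a p x).arr a p = x := by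
  simp [Store.setArr]

theorem Store.arr_setArr_of_ne {p q : List ℕ∞} (h : q ≠ p) (s : Store) (a : Arr) (x : ℕ∞) :
    (s.setArr a p x).arr a q = s.arr a q := by
  simp [Store.setArr, h]

/-- The program `c` leaves unchanged what it does not write to, on the way from `s` to `s'`. -/
structure Frame (c : Cmd) (s s' : Store) : Prop where
  reg : ∀ r, c.writesReg r = false → s'.reg r = s.reg r
  arr : ∀ a, c.writesArr a = false → s'.arr a = s.arr a

theorem Frame.rfl {c : Cmd} {s : Store} : Frame c s s := ⟨fun _ _ => .refl _, fun _ _ => .refl _⟩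

theorem Frame.trans {c : Cmd} {s s' s'' : Store} (h : Frame c s s') (h' : Frame c s' s'') :
    Frame c s s'' :=
  ⟨fun r hr => (h'.reg r hr).trans (h.reg r hr), fun a ha => (h'.arr a ha).trans (h.arr a ha)⟩

theorem Frame.mono {c c' : Cmd} {s s' : Store} (h : Frame c s s')
    (hr : ∀ r, c'.writesReg r = false → c.writesReg r = false)
    (ha : ∀ a, c'.writesArr a = false → c.writesArr a = false) : Frame c' s s' :=
  ⟨fun r h' => h.reg r (hr r h'), fun a h' => h.arr a (ha a h')⟩

/-- Reduces every non-interference claim about a concrete program to a syntactic check, settled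
below by evaluation. -/
theorem Exec.frame {c : Cmd} {s s' : Store} {t : ℕ} (h : Exec c s t s') : Frame c s s' := by
  induction h with
  | skip s => exact .rfl
  | setReg s r e =>
    refine ⟨fun r' hr => Store.reg_setReg_of_ne ?_ _ _, fun _ _ => rfl⟩
    rintro rfl
    simp [Cmd.writesReg] at hr
  | setCell s a rs e =>
    refine ⟨fun _ _ => rfl, fun a' ha => Store.arr_setArr_of_ne_arr ?_ _ _ _⟩
    rintro rfl
    simp [Cmd.writesArr] at ha
  | seq _ _ ih ih' =>
    exact (ih.mono (by simp +contextual [Cmd.writesReg]) (by simp +contextual [Cmd.writesArr])).trans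
      (ih'.mono (by simp [Cmd.writesReg]) (by simp [Cmd.writesArr]))
  | branchTrue _ _ ih =>
    exact ih.mono (by simp +contextual [Cmd.writesReg]) (by simp +contextual [Cmd.writesArr])
  | branchFalse _ _ ih =>
    exact ih.mono (by simp [Cmd.writesReg]) (by simp [Cmd.writesArr])
  | loopTrue _ _ _ ih ih' =>
    exact Frame.trans ⟨ih.reg, ih.arr⟩ ih'
  | loopFalse _ => exact .rfl

/-! ### Rules for the total correctness of programs with a time bound -/

/-- The program `c`, started on `s`, halts within `T` steps with memory contents that satisfy
`Q`. -/
def Runs (c : Cmd) (s : Store) (T : ℕ) (Q : Store → Prop) : Prop :=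
  ∃ t s', Exec c s t s' ∧ t ≤ T ∧ Q s'

namespace Runs

variable {c c' : Cmd} {cs : List Cmd} {s : Store} {T T' : ℕ} {Q Q' : Store → Prop} {b : Test}

theorem mono (h : Runs c s T Q) (hT : T ≤ T') (hQ : ∀ s', Frame c s s' → Q s' → Q' s') :
    Runs c s T' Q' :=
  let ⟨t, s', he, ht, hq⟩ := h
  ⟨t, s', he, ht.trans hT, hQ s' he.frame hq⟩

theorem weaken (h : Runs c s T Q) (hT : T ≤ T') : Runs c s T' Q :=
  h.mono hT fun _ _ h => h

theorem skip (h : Q s) : Runs .skip s 1 Q := ⟨_, _, .skip s, le_rfl, h⟩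

theorem setReg {r : Reg} {e : Exp} (h : Q (s.setReg r (e.eval s))) :
    Runs (.setReg r e) s (e.steps + 1) Q :=
  ⟨_, _, .setReg s r e, le_rfl, h⟩

theorem setCell {a : Arr} {rs : List Reg} {e : Exp}
    (h : Q (s.setArr a (rs.map s.reg) (e.eval s))) :
    Runs (.setCell a rs e) s (rs.length + e.steps + 1) Q :=
  ⟨_, _, .setCell s a rs e, le_rfl, h⟩

theorem seq (h : Runs c s T fun s' => Runs c' s' T' Q) : Runs (.seq c c') s (T + T') Q :=
  let ⟨_, _, he, ht, _, s'', he', ht', hq⟩ := h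
  ⟨_, s'', .seq he he', Nat.add_le_add ht ht', hq⟩

theorem block_nil (h : Q s) : Runs (Cmd.block []) s 1 Q := skip h

theorem block_cons (h : Runs c s T fun s' => Runs (Cmd.block cs) s' T' Q) :
    Runs (Cmd.block (c :: cs)) s (T + T') Q :=
  seq h

theorem branch (hT : b.holds s → Runs c s T Q) (hF : ¬ b.holds s → Runs c' s T Q) :
    Runs (.branch b c c') s (b.steps + 1 + T) Q := by
  by_cases hb : b.holds s
  · obtain ⟨t, s', he, ht, hq⟩ := hT hb
    exact ⟨_, s', .branchTrue hb he, Nat.add_le_add_left ht _, hq⟩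
  · obtain ⟨t, s', he, ht, hq⟩ := hF hb
    exact ⟨_, s', .branchFalse hb he, Nat.add_le_add_left ht _, hq⟩

theorem when (hT : b.holds s → Runs c s T Q) (hF : ¬ b.holds s → Q s) :
    Runs (Cmd.when b c) s (b.steps + 2 + T) Q := by
  have : Runs (Cmd.when b c) s (b.steps + 1 + (T + 1)) Q :=
    branch (fun h => (hT h).weaken (by omega)) fun h => (skip (hF h)).weaken (by omega)
  exact this.weaken (by omega)

theorem whenNot (hT : b.holds s → Q s) (hF : ¬ b.holds s → Runs c s T Q) :
    Runs (Cmd.whenNot b c) s (b.steps + 2 + T) Q := by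
  have : Runs (Cmd.whenNot b c) s (b.steps + 1 + (T + 1)) Q :=
    branch (fun h => (skip (hT h)).weaken (by omega)) fun h => (hF h).weaken (by omega)
  exact this.weaken (by omega)

/-- The rule for counting loops with an invariant `Inv j`, which holds when the counter is `j`. -/
theorem forLoop {r bound : Reg} {N : ℕ} (Inv : ℕ → Store → Prop) (hN : s.reg bound = N)
    (hne : bound ≠ r) (hr : c.writesReg r = false) (hbound : c.writesReg bound = false)
    (h0 : Inv 0 (s.setReg r 0))
    (hstep : ∀ j < N, ∀ s', Frame (Cmd.forLoop r bound c) s s' → s'.reg r = j → Inv j s' →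
      Runs c s' T fun s'' => Inv (j + 1) (s''.setReg r (j + 1 : ℕ))) :
    Runs (Cmd.forLoop r bound c) s (N * (T + 9) + 7) (Inv N) := by
  -- Induction on the number `m` of remaining rounds. Besides the body, a round costs 4 for the
  -- test, 4 for the increment and 1 for the `skip` that closes the block; the final failing test
  -- costs 4.
  have hloop : ∀ m j : ℕ, j + m = N → ∀ s', Frame (Cmd.forLoop r bound c) s s' →
      s'.reg r = j → Inv j s' →
      Runs (.loop (.lt (.reg r) (.reg bound))
        (Cmd.block [c, .setReg r (.add (.reg r) (.const 1))])) s' (m * (T + 9) + 4) (Inv N) := by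
    have hwb : (Cmd.forLoop r bound c).writesReg bound = false := by
      simp [Cmd.forLoop, Cmd.block, Cmd.writesReg, hbound, hne.symm]
    intro m
    induction m with
    | zero =>
      rintro j rfl s' hs' hj hinv
      refine ⟨_, _, .loopFalse ?_, ?_, hinv⟩
      · simp [Test.holds, Exp.eval, hj, hs'.reg _ hwb, hN]
      · simp [Test.steps, Exp.steps]
    | succ m ih =>
      intro j hjm s' hs' hj hinv
      obtain ⟨t, s₁, he, ht, hinv₁⟩ := hstep j (by omega) s' hs' hj hinv
      have hreg : s₁.reg r + 1 = (j + 1 : ℕ) := by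
        rw [he.frame.reg r hr, hj]
        norm_cast
      have hframe : Frame (Cmd.forLoop r bound c) s (s₁.setReg r (j + 1 : ℕ)) := by
        refine hs'.trans ((he.frame.mono ?_ ?_).trans ⟨fun r' hr' => ?_, fun _ _ => rfl⟩)
        · simp +contextual [Cmd.forLoop, Cmd.block, Cmd.writesReg]
        · simp +contextual [Cmd.forLoop, Cmd.block, Cmd.writesArr]
        · refine Store.reg_setReg_of_ne ?_ _ _
          rintro rfl
          simp [Cmd.forLoop, Cmd.block, Cmd.writesReg] at hr'
      obtain ⟨t', s₂, he', ht', hq⟩ := ih (j + 1) (by omega) _ hframe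
        (Store.reg_setReg_self ..) hinv₁
      have hbody := Exec.seq he (.seq (.setReg s₁ r (.add (.reg r) (.const 1))) (.skip _))
      refine ⟨_, s₂, .loopTrue (t' := t') ?_ hbody ?_, ?_, hq⟩
      · simp only [Test.holds, Exp.eval, hj, hs'.reg _ hwb, hN]
        exact_mod_cast (by omega : j < N)
      · simp only [Exp.eval, hreg]
        exact he'
      · simp only [Test.steps, Exp.steps, Nat.succ_mul]
        omega
  -- 2 steps initialise the counter and 1 is the closing `skip`, which makes 7 with the last test.
  have : Runs (Cmd.forLoop r bound c) s (2 + ((N * (T + 9) + 4) + 1)) (Inv N) := by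
    refine block_cons (setReg (block_cons ((hloop N 0 (by omega) _ ?_ ?_ h0).mono le_rfl
      fun _ _ h => block_nil h)))
    · refine ⟨fun r' hr' => Store.reg_setReg_of_ne ?_ _ _, fun _ _ => rfl⟩
      rintro rfl
      simp [Cmd.forLoop, Cmd.block, Cmd.writesReg] at hr'
    · simp [Store.reg_setReg_self]
  exact this.weaken (by omega)

end Runs

/-! ### Correctness and running time of the parts of the fixpoint algorithm -/

/-- The profile in row `j` of the array `a`. -/
def Store.profile (s : Store) (a : Arr) (d : ℕ) (j : ℕ∞) : Profile d :=
  toLex fun i : Fin d => s.arr a [j, ((i : ℕ) : ℕ∞)]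

theorem Store.profile_congr {s s' : Store} {a : Arr} (h : s'.arr a = s.arr a) (d : ℕ) (j : ℕ∞) :
    s'.profile a d j = s.profile a d j := by
  simp [profile, h]

/-- The program does not write to the registers and arrays that hold the input. -/
def Cmd.keepsInput (c : Cmd) : Bool :=
  !c.writesReg .n && !c.writesReg .d && !c.writesArr .edge && !c.writesArr .weight &&
    !c.writesArr .owner && !c.writesArr .target

/-- The expression is evaluated in intermediate stores where the counter and the array `a` have
changed, so `he` asks for its value in all stores that agree with `s` elsewhere. -/
theorem runs_writeRow {a : Arr} {x : Reg} {e : Exp} {s : Store} {d : ℕ} {j : ℕ∞} (f : Profile d)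
    (hx : x ≠ .i) (hxj : s.reg x = j) (hd : s.reg .d = d)
    (he : ∀ s' : Store, (∀ r ≠ .i, s'.reg r = s.reg r) → (∀ b ≠ a, s'.arr b = s.arr b) →
      ∀ i : Fin d, s'.reg .i = (i : ℕ) → e.eval s' = f i) :
    Runs (.forLoop .i .d (.setCell a [x, .i] e)) s (d * (e.steps + 12) + 7) fun s' =>
      s'.profile a d j = f ∧ ∀ j' ≠ j, s'.profile a d j' = s.profile a d j' := by
  have hT : d * (e.steps + 12) + 7 = d * (2 + e.steps + 1 + 9) + 7 := by ring
  rw [hT]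
  refine (Runs.forLoop (fun m s' => (∀ i : Fin d, (i : ℕ) < m → s'.arr a [j, (i : ℕ)] = f i) ∧
    ∀ j' ≠ j, s'.profile a d j' = s.profile a d j') hd (by decide) rfl rfl
    ⟨by simp, fun _ _ => rfl⟩ ?_).mono le_rfl fun s' _ h =>
      ⟨funext fun i => h.1 i i.2, h.2⟩
  intro m hm s' hs' hi ⟨h, hj'⟩
  have hreg : ∀ r ≠ .i, s'.reg r = s.reg r := fun r hr => hs'.reg r (by
    simp [Cmd.forLoop, Cmd.block, Cmd.writesReg, hr.symm])
  have harr : ∀ b ≠ a, s'.arr b = s.arr b := fun b hb => hs'.arr b (by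
    simp [Cmd.forLoop, Cmd.block, Cmd.writesArr, hb.symm])
  refine Runs.setCell ⟨fun i hi' => ?_, fun j' hj => ?_⟩
  · rw [Store.arr_setReg, List.map_cons, List.map_cons, List.map_nil, hi, hreg x hx, hxj]
    rcases Nat.lt_succ_iff_lt_or_eq.1 hi' with h' | h'
    · rw [Store.arr_setArr_of_ne (by simpa using h'.ne), h i h']
    · rw [← h', Store.arr_setArr_self, he s' hreg harr i (h' ▸ hi)]
  · rw [← hj' j' hj]
    funext i
    exact Store.arr_setArr_of_ne (by simp [hreg x hx, hxj, hj]) _ _ _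

section

variable {V : Type*} [Fintype V] {d : ℕ} {G : Game V d} {num : V ≃ Fin (Fintype.card V)}
  {s : Store}

theorem Encodes.frame {c : Cmd} {s' : Store} (hs : Encodes G num s) (h : Frame c s s')
    (hc : c.keepsInput = true) : Encodes G num s' := by
  simp only [Cmd.keepsInput, Bool.and_eq_true, Bool.not_eq_true'] at hc
  obtain ⟨⟨⟨⟨⟨h₁, h₂⟩, h₃⟩, h₄⟩, h₅⟩, h₆⟩ := hc
  constructor
  · rw [h.reg _ h₁]; exact hs.size
  · rw [h.reg _ h₂]; exact hs.dim
  · rw [h.arr _ h₃]; exact hs.edge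
  · rw [h.arr _ h₄]; exact hs.weight
  · rw [h.arr _ h₅]; exact hs.owner
  · rw [h.arr _ h₆]; exact hs.target

theorem natCast_num_ne {v w : V} (h : w ≠ v) : ((num w : ℕ) : ℕ∞) ≠ ((num v : ℕ) : ℕ∞) := by
  simpa [Fin.val_inj] using h

/-- The rule for loops over all vertices, with an invariant that depends on the set of the
processed vertices. -/
theorem Runs.forVertex {c : Cmd} {r : Reg} {T : ℕ} (hs : Encodes G num s)
    (Inv : Set V → Store → Prop) (hne : .n ≠ r) (hr : c.writesReg r = false)
    (hn : c.writesReg .n = false) (h0 : Inv ∅ (s.setReg r 0))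
    (hstep : ∀ S, ∀ w ∉ S, ∀ s', Frame (Cmd.forLoop r .n c) s s' → s'.reg r = (num w : ℕ) →
      Inv S s' → Runs c s' T fun s'' => ∀ x, Inv (insert w S) (s''.setReg r x)) :
    Runs (Cmd.forLoop r .n c) s (Fintype.card V * (T + 9) + 7) (Inv Set.univ) := by
  refine (Runs.forLoop (fun m => Inv {w | (num w : ℕ) < m}) hs.size hne hr hn (by simpa using h0)
    (T := T) ?_).mono le_rfl fun s' _ h => ?_
  · intro m hm s' hs' hm' hinv
    refine (hstep {w | (num w : ℕ) < m} (num.symm ⟨m, hm⟩) (by simp) s' hs' (by simpa using hm')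
      hinv).mono le_rfl fun s'' _ h => ?_
    have : {w | (num w : ℕ) < m + 1} = insert (num.symm ⟨m, hm⟩) {w | (num w : ℕ) < m} := by
      ext w
      simp [le_iff_eq_or_lt, Equiv.eq_symm_apply, Fin.ext_iff]
    simp only [this]
    exact h _
  · have : {w | (num w : ℕ) < Fintype.card V} = Set.univ := Set.eq_univ_of_forall fun w => (num w).2
    rwa [this] at h

namespace Alg

theorem runs_fill {v : V} (hs : Encodes G num s) (hv : s.reg .v = (num v : ℕ)) (c : ℕ∞) :
    Runs (fill c) s (d * 13 + 7) fun s' =>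
      output d num s' v = toLex (fun _ => c) ∧
      ∀ w ≠ v, output d num s' w = output d num s w := by
  refine (runs_writeRow (a := .cur) (x := .v) (e := .const c) (toLex fun _ => c) (by decide) hv
    hs.dim ?_).mono le_rfl fun s' _ h => ⟨h.1, fun w hw => h.2 _ (natCast_num_ne hw)⟩
  intros
  rfl

/-- The profile in `old` at the vertex `v`. -/
def oldProfile (d : ℕ) (num : V ≃ Fin (Fintype.card V)) (s : Store) (v : V) : Profile d :=
  s.profile .old d ((num v : ℕ) : ℕ∞)

theorem eval_candidate {v u : V} {i : Fin d} (hs : Encodes G num s) (hvu : G.Edge v u)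
    (hv : s.reg .v = (num v : ℕ)) (hu : s.reg .u = (num u : ℕ)) (hi : s.reg .i = (i : ℕ)) :
    candidate.eval s = (oldProfile d num s u + G.weightProfile v u) i := by
  have hw : candidate.eval s = s.arr .old [((num u : ℕ) : ℕ∞), (i : ℕ)] +
      s.arr .weight [((num v : ℕ) : ℕ∞), ((num u : ℕ) : ℕ∞), (i : ℕ)] := by
    simp [candidate, Exp.eval, hv, hu, hi]
  rw [hw, hs.weight v u hvu]
  rfl

theorem runs_take {v u : V} (hs : Encodes G num s) (hvu : G.Edge v u)
    (hv : s.reg .v = (num v : ℕ)) (hu : s.reg .u = (num u : ℕ)) :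
    Runs take s (d * 20 + 10) fun s' =>
      output d num s' v = oldProfile d num s u + G.weightProfile v u ∧
      ∀ w ≠ v, output d num s' w = output d num s w := by
  let s₁ := s.setReg .best (s.reg .u)
  have hs₁ : Encodes G num s₁ := ⟨hs.size, hs.dim, hs.edge, hs.weight, hs.owner, hs.target⟩
  have h := runs_writeRow (a := .cur) (x := .v) (e := candidate) (s := s₁) (d := d)
    (oldProfile d num s u + G.weightProfile v u) (by decide) hv hs.dim (by
      intro s' hreg harr i hi
      have hs' : Encodes G num s' := by
        refine ⟨?_, ?_, ?_, ?_, ?_, ?_⟩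
        · rw [hreg _ (by decide)]; exact hs.size
        · rw [hreg _ (by decide)]; exact hs.dim
        · rw [harr _ (by decide)]; exact hs.edge
        · rw [harr _ (by decide)]; exact hs.weight
        · rw [harr _ (by decide)]; exact hs.owner
        · rw [harr _ (by decide)]; exact hs.target
      have hold : oldProfile d num s' u = oldProfile d num s u :=
        Store.profile_congr (harr _ (by decide)) _ _
      rw [eval_candidate hs' hvu ((hreg _ (by decide)).trans hv) ((hreg _ (by decide)).trans hu) hi,
        hold])
  have : Runs take s (2 + ((d * (candidate.steps + 12) + 7) + 1)) _ :=
    Runs.block_cons (Runs.setReg (Runs.block_cons (h.mono le_rfl fun s' _ h' =>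
      Runs.block_nil h')))
  refine this.mono ?_ fun s' _ h' => ⟨h'.1, fun w hw => h'.2 _ (natCast_num_ne hw)⟩
  simp only [candidate, Exp.steps, List.length]
  omega

/-- The number `c` is the outcome of the comparison of `x` with `y`. -/
def Compares (x y : Profile d) (c : ℕ∞) : Prop :=
  x = y ∧ c = 0 ∨ x < y ∧ c = 1 ∨ y < x ∧ c = 2

theorem runs_compare {v u : V} (hs : Encodes G num s) (hvu : G.Edge v u)
    (hv : s.reg .v = (num v : ℕ)) (hu : s.reg .u = (num u : ℕ)) :
    Runs compare s (d * 43 + 10) fun s' => Compares (oldProfile d num s u + G.weightProfile v u)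
      (output d num s v) (s'.reg .cmp) := by
  set x := oldProfile d num s u + G.weightProfile v u with hx
  set y := output d num s v with hy
  let s₁ := s.setReg .cmp 0
  -- Either the first `m` components agree and the comparison is still open, or an earlier component
  -- has decided it for good.
  let Inv : ℕ → Store → Prop := fun m s' =>
    (∀ i : Fin d, (i : ℕ) < m → x i = y i) ∧ s'.reg .cmp = 0 ∨ x < y ∧ s'.reg .cmp = 1 ∨
      y < x ∧ s'.reg .cmp = 2
  have hloop : Runs (.forLoop .i .d (.when (.eq (.reg .cmp) (.const 0))
      (.branch (.lt candidate (.cell .cur [.v, .i])) (.setReg .cmp (.const 1))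
        (.when (.lt (.cell .cur [.v, .i]) candidate) (.setReg .cmp (.const 2))))))
      s₁ (d * (34 + 9) + 7) (Inv d) := by
    refine Runs.forLoop Inv hs.dim (by decide) rfl rfl (Or.inl ⟨by simp, rfl⟩) ?_
    intro m hm s' hs' hi hinv
    have hsub : Frame compare s s' := by
      refine ⟨fun r hr => ?_, fun a ha => hs'.arr a rfl⟩
      have h1 : r ≠ .cmp := by rintro rfl; exact absurd hr (by decide)
      have h2 : r ≠ .i := by rintro rfl; exact absurd hr (by decide)
      rw [hs'.reg r (by revert h1 h2; cases r <;> decide)]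
      exact Store.reg_setReg_of_ne h1 _ _
    have henc : Encodes G num s' := hs.frame hsub (by decide)
    have hcand : candidate.eval s' = x ⟨m, hm⟩ := by
      have hold : oldProfile d num s' u = oldProfile d num s u :=
        Store.profile_congr (hsub.arr _ (by decide)) _ _
      rw [eval_candidate (i := ⟨m, hm⟩) henc hvu ((hsub.reg _ (by decide)).trans hv)
        ((hsub.reg _ (by decide)).trans hu) hi, hold]
    have hcur : (Exp.cell .cur [.v, .i]).eval s' = y ⟨m, hm⟩ := by
      simp only [Exp.eval, List.map_cons, List.map_nil, hi, hsub.reg .v rfl, hv,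
        hsub.arr .cur (by decide)]
      rfl
    have hstep : Runs (.when (.eq (.reg .cmp) (.const 0))
        (.branch (.lt candidate (.cell .cur [.v, .i])) (.setReg .cmp (.const 1))
          (.when (.lt (.cell .cur [.v, .i]) candidate) (.setReg .cmp (.const 2)))))
        s' (3 + 2 + (12 + 1 + (12 + 2 + 2)))
        fun s'' => Inv (m + 1) (s''.setReg .i (m + 1 : ℕ)) := by
      refine Runs.when (fun hz => ?_) fun hz => ?_
      · have hz : s'.reg .cmp = 0 := hz
        have heq : ∀ i : Fin d, (i : ℕ) < m → x i = y i := by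
          rcases hinv with h | h | h
          · exact h.1
          · simp [h.2] at hz
          · simp [h.2] at hz
        refine Runs.branch (fun hlt => ?_) fun hlt => Runs.when (fun hgt => ?_) fun hgt => ?_
        · rw [Test.holds, hcand, hcur] at hlt
          exact (Runs.setReg (Or.inr (Or.inl
            ⟨Profile.lt_iff.2 ⟨_, fun j hj => heq j hj, hlt⟩, rfl⟩))).weaken (by simp [Exp.steps])
        · rw [Test.holds, hcand, hcur] at hgt
          exact Runs.setReg (Or.inr (Or.inr
            ⟨Profile.lt_iff.2 ⟨_, fun j hj => (heq j hj).symm, hgt⟩, rfl⟩))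
        · rw [Test.holds, hcand, hcur] at hlt hgt
          refine Or.inl ⟨fun i hi' => ?_, hz⟩
          rcases Nat.lt_succ_iff_lt_or_eq.1 hi' with h' | h'
          · exact heq i h'
          · obtain rfl : i = ⟨m, hm⟩ := Fin.ext h'
            exact le_antisymm (not_lt.1 hgt) (not_lt.1 hlt)
      · rcases hinv with h | h | h
        · exact absurd h.2 hz
        · exact Or.inr (Or.inl h)
        · exact Or.inr (Or.inr h)
    exact hstep.weaken (by omega)
  have : Runs compare s (2 + ((d * (34 + 9) + 7) + 1)) (Inv d) :=
    Runs.block_cons (Runs.setReg (Runs.block_cons (hloop.mono le_rfl fun s' _ h' =>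
      Runs.block_nil h')))
  exact this.mono (by omega) fun s' _ h => h.imp_left fun h => ⟨funext fun i => h.1 i i.2, h.2⟩

/-- Stated for an abstract strict order so that minimum and maximum are both instances. The initial
value of the row may survive the scan; that case is excluded or absorbed by the caller. -/
theorem runs_scan {v : V} (hs : Encodes G num s) (hv : s.reg .v = (num v : ℕ)) (r : ℕ∞)
    (lt : Profile d → Profile d → Prop) [IsStrictOrder (Profile d) lt]
    (hr : ∀ (x y : Profile d) (c : ℕ∞), Compares x y c → (c = r ↔ lt x y)) :
    Runs (scan r) s (Fintype.card V * (d * 63 + 42) + 7) fun s' =>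
      (output d num s' v = output d num s v ∨
        output d num s' v ∈ G.candidates (oldProfile d num s) v) ∧
      (∀ x ∈ G.candidates (oldProfile d num s) v, ¬ lt x (output d num s' v)) ∧
      ∀ w ≠ v, output d num s' w = output d num s w := by
  let Inv : Set V → Store → Prop := fun S s' =>
    (output d num s' v = output d num s v ∨
        output d num s' v ∈ G.candidates (oldProfile d num s) v) ∧
      (∀ u ∈ S, G.Edge v u →
        ¬ lt (oldProfile d num s u + G.weightProfile v u) (output d num s' v)) ∧
      ∀ w ≠ v, output d num s' w = output d num s w
  have hT : Fintype.card V * (d * 63 + 42) + 7 = Fintype.card V * ((5 + 2 + ((d * 43 + 10) +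
      ((3 + 2 + (d * 20 + 10)) + 1))) + 9) + 7 := by ring
  rw [hT]
  refine (Runs.forVertex hs Inv (by decide) rfl rfl
    ⟨Or.inl rfl, by simp, fun _ _ => rfl⟩ ?_).mono le_rfl fun s' _ h =>
      ⟨h.1, fun x ⟨u, hu, hx⟩ => hx ▸ h.2.1 u trivial hu, h.2.2⟩
  intro S u huS s' hs' hu hinv
  have henc : Encodes G num s' := hs.frame hs' rfl
  have hv' : s'.reg .v = (num v : ℕ) := (hs'.reg .v rfl).trans hv
  have hold : oldProfile d num s' = oldProfile d num s :=
    funext fun w => Store.profile_congr (hs'.arr .old rfl) _ _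
  have hcell : (Exp.cell .edge [.v, .u]).eval s' =
      s'.arr .edge [((num v : ℕ) : ℕ∞), ((num u : ℕ) : ℕ∞)] := by
    simp [Exp.eval, hv', hu]
  refine Runs.when (fun he => ?_) fun he => ?_
  · have hvu : G.Edge v u := by
      rw [Test.holds, hcell, henc.edge] at he
      by_contra h
      simp [h, Exp.eval] at he
    refine Runs.block_cons ((runs_compare henc hvu hv' hu).mono le_rfl fun s₁ hs₁ hcmp => ?_)
    have henc₁ : Encodes G num s₁ := henc.frame hs₁ rfl
    have hout : output d num s₁ = output d num s' :=
      funext fun w => Store.profile_congr (hs₁.arr .cur rfl) _ _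
    have hold₁ : oldProfile d num s₁ = oldProfile d num s :=
      (funext fun w => Store.profile_congr (hs₁.arr .old rfl) _ _).trans hold
    have hiff : s₁.reg .cmp = r ↔
        lt (oldProfile d num s u + G.weightProfile v u) (output d num s' v) := by
      rw [hr _ _ _ hcmp, hold]
    refine Runs.block_cons (Runs.when (fun ht => ?_) fun ht => ?_)
    · have ht := hiff.1 ht
      refine (runs_take henc₁ hvu ((hs₁.reg .v rfl).trans hv') ((hs₁.reg .u rfl).trans hu)).mono
        le_rfl fun s₂ _ ⟨h₁, h₂⟩ => Runs.block_nil fun x => ?_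
      rw [hold₁] at h₁
      rw [hout] at h₂
      have hInv : Inv (insert u S) s₂ := by
        refine ⟨Or.inr ⟨u, hvu, h₁⟩, ?_, fun w hw => (h₂ w hw).trans (hinv.2.2 w hw)⟩
        rw [h₁]
        -- The row has moved strictly in the direction of `lt`, so by transitivity no earlier
        -- candidate can beat the new value.
        rintro u' (rfl | hu') he'
        · exact irrefl_of lt _
        · exact fun hlt => hinv.2.1 u' hu' he' (trans_of lt hlt ht)
      exact hInv
    · refine Runs.block_nil fun x => ?_
      have hInv : Inv (insert u S) s₁ := by
        simp only [Inv, hout]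
        refine ⟨hinv.1, ?_, hinv.2.2⟩
        rintro u' (rfl | hu') he'
        · exact fun hlt => ht (hiff.2 hlt)
        · exact hinv.2.1 u' hu' he'
      exact hInv
  · intro x
    have hvu : ¬ G.Edge v u := fun h => he (by
      rw [Test.holds, hcell, henc.edge]
      simp [h, Exp.eval])
    refine ⟨hinv.1, ?_, hinv.2.2⟩
    rintro u' (rfl | hu') he'
    · exact absurd he' hvu
    · exact hinv.2.1 u' hu' he'

/-- Only the time matters: the strategy tables are never read again, and the frame shows that the
computed profiles are kept. -/
theorem runs_updateStrategy (hs : Encodes G num s) :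
    Runs updateStrategy s (d * 35 + 26) fun _ => True := by
  have h : Runs updateStrategy s (2 + ((d * ((7 + 2 + 2) + 9) + 7) +
      ((3 + 2 + (3 + ((d * (3 + 12) + 7) + 1))) + 1))) fun _ => True := by
    refine Runs.block_cons (Runs.setReg (Runs.block_cons (Runs.mono (Runs.forLoop
      (fun _ _ => True) hs.dim (by decide) rfl rfl trivial fun j _ s' _ _ _ =>
        Runs.whenNot (fun _ => trivial) fun _ => Runs.setReg trivial) le_rfl fun s₁ hs₁ _ => ?_)))
    refine Runs.block_cons (Runs.when (fun _ => Runs.block_cons (Runs.setCell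
      (Runs.block_cons ?_))) fun _ => Runs.block_nil trivial)
    have hd : s₁.reg .d = d := (hs₁.reg .d rfl).trans hs.dim
    refine Runs.mono (runs_writeRow (a := .rest) (x := .v) (e := .cell .old [.best, .i])
      (s₁.profile .old d (s₁.reg .best)) (by decide) rfl hd ?_) le_rfl
        fun _ _ _ => ?_
    rotate_left
    · exact Runs.block_nil (Runs.block_nil trivial)
    intro s' hreg harr i hi
    simp only [Exp.eval, List.map_cons, List.map_nil, hi, hreg .best (by decide),
      harr .old (by decide)]
    rfl
  exact h.weaken (by omega)

end Alg

end

/-! ### One full pass and the main loop -/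

section

variable {V : Type*} [Fintype V] {d : ℕ} {G : Game V d} {num : V ≃ Fin (Fintype.card V)}
  {s : Store}

namespace Alg

theorem runs_update {v : V} (hs : Encodes G num s) (hv : s.reg .v = (num v : ℕ)) :
    Runs update s (Fintype.card V * (d * 63 + 42) + d * 48 + 53) fun s' =>
      (v ∈ G.target → output d num s' v = 0) ∧
      (v ∉ G.target → v ∈ G.V₁ →
        IsLeast (G.candidates (oldProfile d num s) v) (output d num s' v)) ∧
      (v ∉ G.target → v ∉ G.V₁ →
        IsGreatest (G.candidates (oldProfile d num s) v) (output d num s' v)) ∧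
      ∀ w ≠ v, output d num s' w = output d num s w := by
  classical
  have hrun₁ : v ∈ G.V₁ → Runs (.block [fill ⊤, scan 1, updateStrategy]) s
      (d * 13 + 7 + (Fintype.card V * (d * 63 + 42) + 7 + (d * 35 + 26 + 1))) fun s' =>
      IsLeast (G.candidates (oldProfile d num s) v) (output d num s' v) ∧
      ∀ w ≠ v, output d num s' w = output d num s w := fun _ => by
    refine Runs.block_cons ((runs_fill hs hv ⊤).mono le_rfl fun s₁ hs₁ h₁ => ?_)
    have henc₁ := hs.frame hs₁ rfl
    have hold : oldProfile d num s₁ = oldProfile d num s :=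
      funext fun w => Store.profile_congr (hs₁.arr .old rfl) _ _
    refine Runs.block_cons ((runs_scan henc₁ ((hs₁.reg .v rfl).trans hv) 1 (· < ·)
      fun x y c => ?_).mono le_rfl fun s₂ hs₂ h₂ => ?_)
    · rintro (⟨rfl, rfl⟩ | ⟨h, rfl⟩ | ⟨h, rfl⟩)
      · simp only [zero_ne_one, false_iff]
        exact lt_irrefl x
      · simp only [true_iff]
        exact h
      · simp only [OfNat.ofNat_ne_one, false_iff]
        exact h.asymm
    rw [hold] at h₂
    refine Runs.block_cons ((runs_updateStrategy (henc₁.frame hs₂ rfl)).mono le_rfl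
      fun s₃ hs₃ _ => Runs.block_nil ?_)
    have hout : output d num s₃ = output d num s₂ :=
      funext fun w => Store.profile_congr (hs₃.arr .cur rfl) _ _
    rw [hout]
    refine ⟨⟨?_, fun x hx => not_lt.1 (h₂.2.1 x hx)⟩, fun w hw => (h₂.2.2 w hw).trans (h₁.2 w hw)⟩
    -- If no candidate replaced the initial `(∞, …, ∞)`, then no candidate is smaller, so an
    -- arbitrary one equals it and the initial value is itself a candidate.
    rcases h₂.1 with h | h
    · obtain ⟨x, hx⟩ := G.candidates_nonempty (oldProfile d num s) v
      have heq : output d num s₂ v = infProfile d := h.trans h₁.1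
      have hle := not_lt.1 (h₂.2.1 x hx)
      rwa [le_antisymm hle (heq ▸ le_infProfile x)]
    · exact h
  have hrun₂ : v ∉ G.V₁ → Runs (.block [fill 0, scan 2]) s
      (d * 13 + 7 + (Fintype.card V * (d * 63 + 42) + 7 + 1)) fun s' =>
      IsGreatest (G.candidates (oldProfile d num s) v) (output d num s' v) ∧
      ∀ w ≠ v, output d num s' w = output d num s w := fun _ => by
    refine Runs.block_cons ((runs_fill hs hv 0).mono le_rfl fun s₁ hs₁ h₁ => ?_)
    have henc₁ := hs.frame hs₁ rfl
    have hold : oldProfile d num s₁ = oldProfile d num s :=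
      funext fun w => Store.profile_congr (hs₁.arr .old rfl) _ _
    refine Runs.block_cons ((runs_scan henc₁ ((hs₁.reg .v rfl).trans hv) 2 (· > ·)
      fun x y c => ?_).mono le_rfl fun s₂ hs₂ h₂ => Runs.block_nil ?_)
    · rintro (⟨rfl, rfl⟩ | ⟨h, rfl⟩ | ⟨h, rfl⟩)
      · simp only [OfNat.zero_ne_ofNat, false_iff]
        exact lt_irrefl x
      · simp only [OfNat.one_ne_ofNat, false_iff]
        exact h.asymm
      · simp only [true_iff]
        exact h
    rw [hold] at h₂
    refine ⟨⟨?_, fun x hx => not_lt.1 (h₂.2.1 x hx)⟩, fun w hw => (h₂.2.2 w hw).trans (h₁.2 w hw)⟩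
    rcases h₂.1 with h | h
    · obtain ⟨x, hx⟩ := G.candidates_nonempty (oldProfile d num s) v
      have heq : output d num s₂ v = 0 := h.trans h₁.1
      have hle := not_lt.1 (h₂.2.1 x hx)
      rwa [le_antisymm (heq ▸ Profile.zero_le x) hle]
    · exact h
  have htarget : (Test.eq (.cell .target [.v]) (.const 1)).holds s ↔ v ∈ G.target := by
    simp only [Test.holds, Exp.eval, List.map_cons, List.map_nil, hv, hs.target]
    split_ifs with h <;> simp [h]
  have howner : (Test.eq (.cell .owner [.v]) (.const 1)).holds s ↔ v ∈ G.V₁ := by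
    simp only [Test.holds, Exp.eval, List.map_cons, List.map_nil, hv, hs.owner]
    split_ifs with h <;> simp [h]
  refine Runs.weaken (T := 4 + 1 + (4 + 1 + (d * 13 + 7 + (Fintype.card V * (d * 63 + 42) + 7 +
    (d * 35 + 26 + 1))))) ?_ (by omega)
  refine Runs.branch (fun h => ?_) fun h => Runs.branch (fun h₁ => ?_) fun h₁ => ?_
  · have h := htarget.1 h
    exact (runs_fill hs hv 0).mono (by omega) fun s' _ hs' =>
      ⟨fun _ => hs'.1, fun h' => absurd h h', fun h' => absurd h h', hs'.2⟩
  · have h := (not_congr htarget).1 h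
    have h₁ := howner.1 h₁
    exact (hrun₁ h₁).mono le_rfl fun s' _ hs' =>
      ⟨fun h' => absurd h' h, fun _ _ => hs'.1, fun _ h' => absurd h₁ h', hs'.2⟩
  · have h := (not_congr htarget).1 h
    have h₁ := (not_congr howner).1 h₁
    exact (hrun₂ h₁).mono (by omega) fun s' _ hs' =>
      ⟨fun h' => absurd h' h, fun _ h' => absurd h' h₁, fun _ _ => hs'.1, hs'.2⟩

theorem runs_init (hs : Encodes G num s) :
    Runs init s (Fintype.card V * (d * 13 + 21) + 7) fun s' => output d num s' = G.val 0 := by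
  classical
  have hT : Fintype.card V * (d * 13 + 21) + 7 =
      Fintype.card V * (4 + 1 + (d * 13 + 7) + 9) + 7 := by ring
  rw [hT]
  refine (Runs.forVertex hs (fun S s' => ∀ w ∈ S, output d num s' w = G.val 0 w) (by decide)
    rfl rfl (by simp) ?_).mono le_rfl fun s' _ h => funext fun w => h w trivial
  intro S v hvS s' hs' hv hinv
  have henc := hs.frame hs' rfl
  have htarget : (Test.eq (.cell .target [.v]) (.const 1)).holds s' ↔ v ∈ G.target := by
    simp only [Test.holds, Exp.eval, List.map_cons, List.map_nil, hv, henc.target]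
    split_ifs with h <;> simp [h]
  have hfill : ∀ c : ℕ∞, G.val 0 v = toLex (fun _ => c) → Runs (fill c) s' (d * 13 + 7) fun s'' =>
      ∀ x, ∀ w ∈ insert v S, output d num (s''.setReg .v x) w = G.val 0 w := by
    refine fun c hc => (runs_fill henc hv c).mono le_rfl fun s'' _ h x w hw => ?_
    by_cases hwv : w = v
    · exact hwv ▸ h.1.trans hc.symm
    · exact (h.2 w hwv).trans (hinv w (hw.resolve_left hwv))
  refine Runs.branch (fun h => hfill 0 ?_) fun h => hfill ⊤ ?_
  · exact G.val_of_mem_target 0 (htarget.1 h)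
  · exact G.val_zero_of_notMem_target ((not_congr htarget).1 h)

theorem runs_copy (hs : Encodes G num s) :
    Runs (.forLoop .v .n (.forLoop .i .d (.setCell .old [.v, .i] (.cell .cur [.v, .i])))) s
      (Fintype.card V * (d * 15 + 16) + 7) fun s' => oldProfile d num s' = output d num s := by
  refine (Runs.forVertex hs (T := d * (3 + 12) + 7)
    (fun S s' => ∀ w ∈ S, oldProfile d num s' w = output d num s w) (by decide)
    rfl rfl (by simp) ?_).mono le_rfl fun s' _ h => funext fun w => h w trivial
  intro S v hvS s' hs' hv hinv
  refine (runs_writeRow (output d num s v) (by decide) hv (hs.frame hs' rfl).dim ?_).mono le_rfl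
    fun s'' _ h x w hw => ?_
  · intro s'' hreg harr i hi
    simp only [Exp.eval, List.map_cons, List.map_nil, hi, hreg .v (by decide), hv,
      harr .cur (by decide), hs'.arr .cur rfl]
    rfl
  · by_cases hwv : w = v
    · exact hwv ▸ h.1
    · exact (h.2 _ (natCast_num_ne hwv)).trans (hinv w (hw.resolve_left hwv))

theorem runs_updateAll (hs : Encodes G num s) :
    Runs (.forLoop .v .n update) s
      (Fintype.card V * (Fintype.card V * (d * 63 + 42) + d * 48 + 53 + 9) + 7) fun s' =>
      G.IsUpdate (oldProfile d num s) (output d num s') := by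
  refine (Runs.forVertex hs (fun S s' => ∀ w ∈ S,
    (w ∈ G.target → output d num s' w = 0) ∧
      (w ∉ G.target → w ∈ G.V₁ →
        IsLeast (G.candidates (oldProfile d num s) w) (output d num s' w)) ∧
      (w ∉ G.target → w ∉ G.V₁ →
        IsGreatest (G.candidates (oldProfile d num s) w) (output d num s' w))) (by decide)
    rfl rfl (by simp) ?_).mono le_rfl fun s' _ h =>
      ⟨fun v => (h v trivial).1, fun v => (h v trivial).2.1, fun v => (h v trivial).2.2⟩
  intro S v hvS s' hs' hv hinv
  have hold : oldProfile d num s' = oldProfile d num s :=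
    funext fun w => Store.profile_congr (hs'.arr .old rfl) _ _
  refine (runs_update (hs.frame hs' rfl) hv).mono le_rfl fun s'' _ h x w hw => ?_
  rw [hold] at h
  by_cases hwv : w = v
  · subst hwv
    exact ⟨h.1, h.2.1, h.2.2.1⟩
  · have heq : output d num (s''.setReg .v x) w = output d num s' w := h.2.2.2 w hwv
    rw [heq]
    exact hinv w (hw.resolve_left hwv)

theorem runs_checkChanged (hs : Encodes G num s) (h0 : s.reg .changed = 0) :
    Runs (.forLoop .v .n (.forLoop .i .d (.whenNot
      (.eq (.cell .cur [.v, .i]) (.cell .old [.v, .i])) (.setReg .changed (.const 1))))) s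
      (Fintype.card V * (d * 20 + 16) + 7) fun s' =>
      s'.reg .changed = 0 ∧ output d num s = oldProfile d num s ∨
      s'.reg .changed = 1 ∧ output d num s ≠ oldProfile d num s := by
  refine (Runs.forVertex hs (T := d * (7 + 2 + 2 + 9) + 7) (fun S s' =>
      s'.reg .changed = 0 ∧ (∀ w ∈ S, output d num s w = oldProfile d num s w) ∨
      s'.reg .changed = 1 ∧ output d num s ≠ oldProfile d num s) (by decide)
    rfl rfl (Or.inl ⟨(Store.reg_setReg_of_ne (by decide) _ _).trans h0, by simp⟩) ?_).mono le_rfl fun s' _ h =>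
      h.imp_left fun h => ⟨h.1, funext fun w => h.2 w trivial⟩
  intro S v hvS s' hs' hv hinv
  refine (Runs.forLoop (fun m s'' =>
      s''.reg .changed = 0 ∧ (∀ w ∈ S, output d num s w = oldProfile d num s w) ∧
        (∀ i : Fin d, (i : ℕ) < m → output d num s v i = oldProfile d num s v i) ∨
      s''.reg .changed = 1 ∧ output d num s ≠ oldProfile d num s) (hs.frame hs' rfl).dim
      (by decide) rfl rfl ?_ ?_).mono le_rfl fun s'' _ h x => ?_
  · exact hinv.imp_left fun h => ⟨h.1, h.2, by simp⟩
  · intro m hm s₁ hs₁ hi hinv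
    have hrow : ∀ a, a = .cur ∨ a = .old → (Exp.cell a [.v, .i]).eval s₁ =
        s.profile a d ((num v : ℕ) : ℕ∞) ⟨m, hm⟩ := by
      rintro a (rfl | rfl) <;>
      · simp only [Exp.eval, List.map_cons, List.map_nil, hi, hs₁.reg .v rfl, hv,
          hs₁.arr _ rfl, hs'.arr _ rfl]
        rfl
    have hcur : (Exp.cell .cur [.v, .i]).eval s₁ = output d num s v ⟨m, hm⟩ := hrow _ (Or.inl rfl)
    have hold : (Exp.cell .old [.v, .i]).eval s₁ = oldProfile d num s v ⟨m, hm⟩ :=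
      hrow _ (Or.inr rfl)
    refine Runs.whenNot (fun heq => ?_) fun hne => Runs.setReg (Or.inr ⟨rfl, fun h => hne ?_⟩)
    · rw [Test.holds, hcur, hold] at heq
      refine hinv.imp_left fun h => ⟨h.1, h.2.1, fun i hi' => ?_⟩
      rcases Nat.lt_succ_iff_lt_or_eq.1 hi' with h' | h'
      · exact h.2.2 i h'
      · obtain rfl : i = ⟨m, hm⟩ := Fin.ext h'
        exact heq
    · rw [Test.holds, hcur, hold, h]
  · refine h.imp_left fun h => ⟨h.1, ?_⟩
    rintro w (rfl | hw)
    · exact funext fun i => h.2.2 i i.2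
    · exact h.2.1 w hw

theorem runs_pass [Nonempty V] (hs : Encodes G num s) (hd : 1 ≤ d) :
    Runs pass s (400 * (Fintype.card V ^ 2 * d)) fun s' =>
      G.IsUpdate (output d num s) (output d num s') ∧
      (s'.reg .changed = 0 ∧ output d num s' = output d num s ∨
        s'.reg .changed = 1 ∧ output d num s' ≠ output d num s) := by
  have hrun : Runs pass s (Fintype.card V * (d * 15 + 16) + 7 +
      (Fintype.card V * (Fintype.card V * (d * 63 + 42) + d * 48 + 53 + 9) + 7 +
        (2 + (Fintype.card V * (d * 20 + 16) + 7 + 1)))) fun s' =>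
      G.IsUpdate (output d num s) (output d num s') ∧
      (s'.reg .changed = 0 ∧ output d num s' = output d num s ∨
        s'.reg .changed = 1 ∧ output d num s' ≠ output d num s) := by
    refine Runs.block_cons ((runs_copy hs).mono le_rfl fun s₁ hs₁ h₁ => ?_)
    have henc₁ := hs.frame hs₁ rfl
    refine Runs.block_cons ((runs_updateAll henc₁).mono le_rfl fun s₂ hs₂ h₂ =>
      Runs.block_cons (Runs.setReg ?_))
    have henc₂ := henc₁.frame hs₂ rfl
    have henc₃ : Encodes G num (s₂.setReg .changed 0) :=
      ⟨henc₂.size, henc₂.dim, henc₂.edge, henc₂.weight, henc₂.owner, henc₂.target⟩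
    have hold : oldProfile d num s₂ = output d num s :=
      (funext fun w => Store.profile_congr (hs₂.arr .old rfl) _ _ :
        oldProfile d num s₂ = oldProfile d num s₁).trans h₁
    refine Runs.block_cons ((runs_checkChanged henc₃ (Store.reg_setReg_self ..)).mono le_rfl
      fun s₃ hs₃ h₃ => Runs.block_nil ?_)
    have hout : output d num s₃ = output d num s₂ :=
      funext fun w => Store.profile_congr (hs₃.arr .cur rfl) _ _
    rw [h₁] at h₂
    rw [hout]
    refine ⟨h₂, ?_⟩
    rw [← hold]
    exact h₃
  refine hrun.weaken ?_
  -- Every term of the sum is absorbed by `N ^ 2 * d`; the terms free of `d` or of `N` need `1 ≤ d`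
  -- and `1 ≤ N`.
  have hN : 1 ≤ Fintype.card V := Fintype.card_pos
  generalize Fintype.card V = N at hN
  have h₁ : N ^ 2 ≤ N ^ 2 * d := Nat.le_mul_of_pos_right _ hd
  have h₂ : N * d ≤ N ^ 2 * d := Nat.mul_le_mul_right d (Nat.le_self_pow two_ne_zero N)
  have h₃ : N ≤ N * d := Nat.le_mul_of_pos_right _ hd
  nlinarith

/-- The number `m = |V| - j` bounds the passes still possible. The flag compares iterates `j + 1`
and `j`, so at `j = |V|` stabilisation forces it to be `0` and the loop to stop. -/
theorem runs_loop_pass [Nonempty V] (hd : 1 ≤ d) (m j : ℕ) (hjm : j + m = Fintype.card V)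
    (hs : Encodes G num s) (hval : output d num s = G.val (j + 1))
    (hchanged : s.reg .changed = 0 ∧ G.val (j + 1) = G.val j ∨
      s.reg .changed = 1 ∧ G.val (j + 1) ≠ G.val j) :
    Runs (.loop (.eq (.reg .changed) (.const 1)) pass) s
      (m * (400 * (Fintype.card V ^ 2 * d) + 4) + 4) fun s' =>
      ∃ k ≤ Fintype.card V, G.val (k + 1) = G.val k ∧ output d num s' = G.val k := by
  have hexit : s.reg .changed = 0 → G.val (j + 1) = G.val j →
      Runs (.loop (.eq (.reg .changed) (.const 1)) pass) s 4 fun s' =>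
        ∃ k ≤ Fintype.card V, G.val (k + 1) = G.val k ∧ output d num s' = G.val k :=
    fun h0 heq => ⟨_, s, .loopFalse (by simp [Test.holds, Exp.eval, h0]), le_rfl, j, by omega, heq,
      hval.trans heq⟩
  induction m generalizing j s with
  | zero =>
    rcases hchanged with h | h
    · exact (hexit h.1 h.2).weaken (by omega)
    · refine absurd ?_ h.2
      rw [G.val_eq_val_card (by omega : Fintype.card V ≤ j + 1),
        G.val_eq_val_card (by omega : Fintype.card V ≤ j)]
  | succ m ih =>
    rcases hchanged with h | h
    · exact (hexit h.1 h.2).weaken (by omega)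
    · obtain ⟨t, s₁, he, ht, hupd, hch⟩ := runs_pass hs hd
      have henc := hs.frame he.frame rfl
      rw [hval] at hupd hch
      -- Updates are unique, so the pass has produced exactly the next iterate.
      have hval₁ : output d num s₁ = G.val (j + 1 + 1) := hupd.unique (G.isUpdate_val (j + 1))
      rw [hval₁] at hch
      obtain ⟨t', s₂, he', ht', hq⟩ := ih (j + 1) (by omega) henc hval₁ hch
        fun h0 heq => ⟨_, s₁, .loopFalse (by simp [Test.holds, Exp.eval, h0]), le_rfl, j + 1,
          by omega, heq, hval₁.trans heq⟩
      refine ⟨_, s₂, .loopTrue h.1 he he', ?_, hq⟩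
      rw [Nat.succ_mul]
      change 3 + 1 + t + t' ≤ _
      omega

theorem runs_fixpoint [Nonempty V] (hs : Encodes G num s) (hd : 1 ≤ d) :
    Runs fixpoint s (1000 * (Fintype.card V ^ 3 * d)) fun s' =>
      ∃ k ≤ Fintype.card V, G.val (k + 1) = G.val k ∧ output d num s' = G.val k := by
  have hrun : Runs fixpoint s (Fintype.card V * (d * 13 + 21) + 7 +
      (400 * (Fintype.card V ^ 2 * d) +
        (Fintype.card V * (400 * (Fintype.card V ^ 2 * d) + 4) + 4 + 1))) fun s' =>
      ∃ k ≤ Fintype.card V, G.val (k + 1) = G.val k ∧ output d num s' = G.val k := by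
    refine Runs.block_cons ((runs_init hs).mono le_rfl fun s₁ hs₁ h₁ => ?_)
    have henc₁ := hs.frame hs₁ rfl
    refine Runs.block_cons ((runs_pass henc₁ hd).mono le_rfl fun s₂ hs₂ ⟨hupd, hch⟩ => ?_)
    rw [h₁] at hupd hch
    have hval : output d num s₂ = G.val (0 + 1) := hupd.unique (G.isUpdate_val 0)
    rw [hval] at hch
    exact Runs.block_cons ((runs_loop_pass hd _ 0 (Nat.zero_add _) (henc₁.frame hs₂ rfl) hval
      hch).mono le_rfl fun _ _ h => Runs.block_nil h)
  refine hrun.weaken ?_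
  have hN : 1 ≤ Fintype.card V := Fintype.card_pos
  generalize Fintype.card V = N at hN
  have h₁ : N ^ 2 * d ≤ N ^ 3 * d :=
    Nat.mul_le_mul_right d (Nat.pow_le_pow_right hN (by omega))
  have h₂ : N * d ≤ N ^ 2 * d := Nat.mul_le_mul_right d (Nat.le_self_pow two_ne_zero N)
  have h₃ : N ≤ N * d := Nat.le_mul_of_pos_right _ hd
  nlinarith

end Alg

end

end MultiReach

/-! ### The main theorem -/

theorem mainTheorem4 :
    ∃ C : ℕ, ∀ (V : Type*) [Fintype V] [Nonempty V] (d : ℕ) (_ : 1 ≤ d)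
      (G : MultiReach.Game V d),
      (∃ val : ℕ → V → MultiReach.Profile d,
        (∀ k v, G.iter k v = {val k v}) ∧
        (∀ k, ∀ v ∉ G.target, v ∈ G.V₁ →
          IsLeast {x | ∃ u, G.Edge v u ∧ x = val k u + G.weightProfile v u} (val (k + 1) v)) ∧
        (∀ k, ∀ v ∉ G.target, v ∉ G.V₁ →
          IsGreatest {x | ∃ u, G.Edge v u ∧ x = val k u + G.weightProfile v u}
            (val (k + 1) v))) ∧
      ∀ (num : V ≃ Fin (Fintype.card V)) (s : MultiReach.Store), MultiReach.Encodes G num s →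
        ∃ (t : ℕ) (s' : MultiReach.Store),
          MultiReach.Exec MultiReach.Alg.fixpoint s t s' ∧
          t ≤ C * (Fintype.card V ^ 3 * d) ∧
          (∀ v, G.upperValue v = {MultiReach.output d num s' v}) ∧
          ∃ k ≤ Fintype.card V, ∀ v,
            G.iter (k + 1) v = G.iter k v ∧ G.iter k v = {MultiReach.output d num s' v} := by
  refine ⟨1000, fun V _ _ d hd G => ⟨⟨G.val, G.iter_eq_singleton_val,
    fun k => (G.isUpdate_val k).isLeast, fun k => (G.isUpdate_val k).isGreatest⟩,
    fun num s hs => ?_⟩⟩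
  obtain ⟨t, s', he, ht, k, hk, hfix, hout⟩ := MultiReach.Alg.runs_fixpoint hs hd
  refine ⟨t, s', he, ht, fun v => ?_, k, hk, fun v => ⟨?_, ?_⟩⟩
  · rw [hout, G.upperValue_eq_singleton_val hfix]
  · rw [G.iter_eq_singleton_val, G.iter_eq_singleton_val, hfix]
  · rw [G.iter_eq_singleton_val, hout]
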